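/- Let $0<\alpha<1$, $b\in\mathbb{R}$, and let $g:(-\infty,b)\to\mathbb{R}$ be continuous (no behaviour of $g$ at $b$ is prescribed). For $\beta>0$ let $$I_{b^-}^{\beta}[f](t)=\frac{1}{\Gamma(\beta)}\int_t^b (s-t)^{\beta-1}f(s)\,ds$$ be the right Riemann--Liouville fractional integral, and let $D_{b^-}^{\alpha}[f]=-\frac{d}{dt}I_{b^-}^{1-\alpha}[f]$ be the right Riemann--Liouville fractional derivative, defined for $f\in L^1_{loc}((-\infty,b])$ such that $I_{b^-}^{1-\alpha}[f]$ has a representative that is absolutely continuous on every compact subinterval of $(-\infty,b]$; $I_{b^-}^{1-\alpha}[f](b)$ is the value of this representative at $b$, that is, the limit of $I_{b^-}^{1-\alpha}[f](t)$ as $t\to b^-$. Let $x_b\in\mathbb{R}$ and let $x$, continuous on $(-\infty,b)$, be a function which has a right Riemann--Liouville fractional derivative of order $\alpha$ in this sense and solves $$D_{b^-}^{\alpha}[x](t)=g(t)\,x(t)\ \text{ for (almost) every } t<b,\qquad I_{b^-}^{1-\alpha}[x](b)=x_b .$$ If $x_b>0$, then $x(t)>0$ for all $t\in(-\infty,b)$;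 if $x_b<0$, then $x(t)<0$ for all $t\in(-\infty,b)$. -/

import Mathlib

open MeasureTheory Set

noncomputable section

/-- The right Riemann--Liouville fractional integral
`I_{b-}^β [f](t) = (1 / Γ(β)) ∫_t^b (s - t)^(β - 1) f(s) ds` (for `t ≤ b`, `β > 0`), and
`I_{b-}^0 [f] = f`. -/
def rightRLIntegral (β b : ℝ) (f : ℝ → ℝ) (t : ℝ) : ℝ :=
  if β = 0 then f t
  else 1 / Real.Gamma β * ∫ s in t..b, (s - t) ^ (β - 1) * f s

/-- `f` possesses a right Riemann--Liouville fractional derivative of order `α` on `(-∞, b]`: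
`f ∈ L¹_loc((-∞, b])` and `I_{b-}^{1-α} [f] ∈ AC_loc((-∞, b])`.
As usual, the latter is understood up to equality almost everywhere, and `J` is the (unique on
`(-∞, b]`) locally absolutely continuous representative of `I_{b-}^{1-α} [f]`.  In particular
the value of `I_{b-}^{1-α} [f]` at the endpoint `b` is `J b = lim_{t → b⁻} I_{b-}^{1-α} [f](t)`
(the integral over the degenerate interval `[b, b]` carries no information). -/
structure IsRightRLPrimitive (α b : ℝ) (f J : ℝ → ℝ) : Prop where
  locallyIntegrableOn : LocallyIntegrableOn f (Iic b) volume
  ae_eq : ∀ᵐ t ∂(volume.restrict (Iic b)), J t = rightRLIntegral (1 - α) b f t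
  absolutelyContinuous : ∀ a < b, AbsolutelyContinuousOnInterval J a b

/-- `x` is a (continuous) solution on `(-∞, b)` of the initial value problem
`D_{b-}^α [x](t) = g(t) x(t)`, `I_{b-}^{1-α} [x](b) = xb`, where
`D_{b-}^α [x] = - (d/dt) I_{b-}^{1-α} [x]`.
The equation is only required to hold almost everywhere. -/
structure IsRightRLSolution (α b : ℝ) (g : ℝ → ℝ) (xb : ℝ) (x : ℝ → ℝ) : Prop where
  continuousOn : ContinuousOn x (Iio b)
  exists_primitive : ∃ J : ℝ → ℝ, IsRightRLPrimitive α b x J ∧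
    (∀ᵐ t ∂(volume.restrict (Iio b)), -deriv J t = g t * x t) ∧ J b = xb

end

/-!
Put `y t = x (b - t)` and `h t = g (b - t) * y t` for `t > 0`. Then the fractional integral of
order `1 - α` of `y` is `y₀ + ∫ h` with `y₀ = xb`, and `h` is integrable near `0`. If `y` were
known to be positive near `0`, a first-zero argument would suffice; but nothing is assumed about
`g` at `b`, so sign changes of `y` accumulating at `0` have to be excluded as well.

The basic tool is `IsForwardSolution.restart`. With `c = Γ(α) Γ(1 - α)`, for almost all `s < p`,
`c y(p) = (p - s)^α ∫_0^s (s - r)^(-α) (p - r)⁻¹ y(r) dr + Γ(1 - α) ∫_s^p (p - r)^(α - 1) h(r) dr`,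
where the kernel in the first term, divided by `c`, has mass at most one as a function of
`p = s + δ` for fixed `r` and `δ` (`lintegral_overshoot_le`). It is used in two ways.

* Applied with `s = t - δ` and integrated over `t`, it bounds the exchange of mass between
  `{y ≤ 0}` and `{y > 0}`. Let `F(t)` be the integral of `(t - r)^(-1 - α)` over `r < t` against
  the positive part of `y` if `y t ≤ 0`, and against the negative part otherwise (`signFlux` with
  `δ = 0`). Then, on letting `δ → 0`, the integral of `F` over `(σ, τ)` is at most `C ∫_0^τ |h|`
  whenever `0 < σ < τ`, and this tends to `0` with `τ`
  (`IsForwardSolution.setLIntegral_signFlux_zero_le`).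
* Applied with `s → p⁻` at a zero `p` of `y` such that `y > 0` on `(s₀, p)`, it gives
  `∫_0^{s₀} (p - r)^(-1 - α) y(r) dr ≤ 0` (`IsForwardSolution.setIntegral_le_zero_of_zero`).

On the other hand `∫_0^s y ≥ c₀ s^α` for small `s`, as `y₀ > 0`. Suppose `y τ ≤ 0` with `τ` small
and let `τ / 2 < t < τ`. If `y t ≤ 0`, this lower bound gives `F(t) ≥ c₁ / τ` directly. If
`y t > 0`, let `p ≤ τ` be the first zero after `t`; at `p` the negative part before `t` weighs at
least as much as the positive part, and since it weighs even more at `t`, again `F(t) ≥ c₁ / τ`.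
Hence the integral of `F` over `(τ / 2, τ)` is at least `c₁ / 2`, a contradiction. So `y > 0` near
`0`, and then the same balance at the first zero, where now there is no negative part at all,
shows that there is no zero.
-/

/-! ### Integrals of power kernels -/

/-- The fundamental theorem of calculus for a nonnegative derivative: integrability is automatic. -/
lemma integrableOn_and_setIntegral_of_hasDerivAt {F k : ℝ → ℝ} {a b : ℝ} (hab : a ≤ b)
    (hF : ContinuousOn F (Icc a b)) (hd : ∀ v ∈ Ioo a b, HasDerivAt F (k v) v)
    (hk : ∀ v ∈ Ioo a b, 0 ≤ k v) :
    IntegrableOn k (Ioo a b) ∧ ∫ v in Ioo a b, k v = F b - F a := by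
  have h1 : IntegrableOn k (Ioc a b) := intervalIntegral.integrableOn_deriv_of_nonneg hF hd hk
  refine ⟨h1.mono_set Ioo_subset_Ioc_self, ?_⟩
  rw [← integral_Ioc_eq_integral_Ioo, ← intervalIntegral.integral_of_le hab]
  exact intervalIntegral.integral_eq_sub_of_hasDerivAt_of_le hab hF hd
    ((intervalIntegrable_iff_integrableOn_Ioc_of_le hab).2 h1)

lemma setLIntegral_ofReal_eq {k : ℝ → ℝ} {S : Set ℝ} (hS : MeasurableSet S)
    (hi : IntegrableOn k S) (hk : ∀ v ∈ S, 0 ≤ k v) :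
    ∫⁻ v in S, ENNReal.ofReal (k v) = ENNReal.ofReal (∫ v in S, k v) :=
  (ofReal_integral_eq_lintegral_ofReal hi ((ae_restrict_iff' hS).2 (ae_of_all _ hk))).symm

lemma integrableOn_and_setIntegral_of_setLIntegral {k : ℝ → ℝ} {S : Set ℝ} {C : ℝ}
    (hS : MeasurableSet S) (hm : Measurable k) (hk : ∀ v ∈ S, 0 ≤ k v) (hC : 0 ≤ C)
    (h : ∫⁻ v in S, ENNReal.ofReal (k v) = ENNReal.ofReal C) :
    IntegrableOn k S ∧ ∫ v in S, k v = C := by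
  have hk' : 0 ≤ᵐ[volume.restrict S] k := (ae_restrict_iff' hS).2 (ae_of_all _ hk)
  constructor
  · refine ⟨hm.aestronglyMeasurable, ?_⟩
    rw [hasFiniteIntegral_iff_ofReal hk', h]
    exact ENNReal.ofReal_lt_top
  · rw [integral_eq_lintegral_of_nonneg_ae hk' hm.aestronglyMeasurable, h, ENNReal.toReal_ofReal hC]

section

variable {α : ℝ}

lemma integral_left_power (h0 : 0 < α) {r t : ℝ} (hrt : r ≤ t) :
    IntegrableOn (fun v => (t - v) ^ (α - 1)) (Ioo r t) ∧
      ∫ v in Ioo r t, (t - v) ^ (α - 1) = (t - r) ^ α / α := by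
  have := integrableOn_and_setIntegral_of_hasDerivAt (F := fun v => -((t - v) ^ α / α))
    (k := fun v => (t - v) ^ (α - 1)) hrt ?_ ?_ ?_
  · refine ⟨this.1, this.2.trans ?_⟩
    simp [Real.zero_rpow h0.ne']
  · exact (((continuous_const.sub continuous_id).continuousOn.rpow_const
      fun x _ => Or.inr h0.le).div_const _).neg
  · intro v hv
    have h1 : HasDerivAt (fun v : ℝ => t - v) (-1) v := by
      simpa using (hasDerivAt_id v).const_sub t
    have h2 := ((h1.rpow_const (p := α) (Or.inl (sub_pos.2 hv.2).ne')).div_const α).neg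
    refine h2.congr_deriv ?_
    field_simp
  · exact fun v hv => Real.rpow_nonneg (sub_pos.2 hv.2).le _

lemma integral_right_power (h0 : 0 < α) {r t : ℝ} (hrt : r ≤ t) :
    IntegrableOn (fun v => (v - r) ^ (α - 1)) (Ioo r t) ∧
      ∫ v in Ioo r t, (v - r) ^ (α - 1) = (t - r) ^ α / α := by
  have := integrableOn_and_setIntegral_of_hasDerivAt (F := fun v => (v - r) ^ α / α)
    (k := fun v => (v - r) ^ (α - 1)) hrt ?_ ?_ ?_
  · refine ⟨this.1, this.2.trans ?_⟩
    simp [Real.zero_rpow h0.ne']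
  · exact (((continuous_id.sub continuous_const).continuousOn.rpow_const
      fun x _ => Or.inr h0.le).div_const _)
  · intro v hv
    have h1 : HasDerivAt (fun v : ℝ => v - r) 1 v := (hasDerivAt_id v).sub_const r
    have h2 := ((h1.rpow_const (p := α) (Or.inl (sub_pos.2 hv.1).ne')).div_const α)
    refine h2.congr_deriv ?_
    field_simp
  · exact fun v hv => Real.rpow_nonneg (sub_pos.2 hv.1).le _

lemma integral_shifted_power (h1 : α < 1) {r s p : ℝ} (hrs : r ≤ s) (hsp : s < p) :
    IntegrableOn (fun v => (p - v) ^ (α - 2)) (Ioo r s) ∧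
      ∫ v in Ioo r s, (p - v) ^ (α - 2) = ((p - s) ^ (α - 1) - (p - r) ^ (α - 1)) / (1 - α) := by
  have h1' : 1 - α ≠ 0 := by linarith
  have := integrableOn_and_setIntegral_of_hasDerivAt (F := fun v => (p - v) ^ (α - 1) / (1 - α))
    (k := fun v => (p - v) ^ (α - 2)) hrs ?_ ?_ ?_
  · refine ⟨this.1, this.2.trans ?_⟩
    ring
  · exact ((continuous_const.sub continuous_id).continuousOn.rpow_const
      fun x hx => Or.inl ((sub_pos.2 (hx.2.trans_lt hsp)).ne')).div_const _
  · intro v hv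
    have hpv : 0 < p - v := by have := hv.2; linarith
    have h1 : HasDerivAt (fun v : ℝ => p - v) (-1) v := by
      simpa using (hasDerivAt_id v).const_sub p
    have h2 := ((h1.rpow_const (p := α - 1) (Or.inl hpv.ne')).div_const (1 - α))
    refine h2.congr_deriv ?_
    rw [show α - 1 - 1 = α - 2 by ring]
    field_simp
    ring
  · exact fun v hv => Real.rpow_nonneg (by have := hv.2; linarith) _

/-- The antiderivative is `((v - r) / (p - v)) ^ (1 - α) / ((1 - α) * (p - r))`. -/
lemma integral_mixed_power (h1 : α < 1) {r s p : ℝ} (hrs : r ≤ s) (hsp : s < p) :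
    IntegrableOn (fun v => (p - v) ^ (α - 2) * (v - r) ^ (-α)) (Ioo r s) ∧
      ∫ v in Ioo r s, (p - v) ^ (α - 2) * (v - r) ^ (-α) =
        (s - r) ^ (1 - α) * (p - s) ^ (α - 1) / ((1 - α) * (p - r)) := by
  have h1' : 0 < 1 - α := by linarith
  have hpr : 0 < p - r := by linarith
  have := integrableOn_and_setIntegral_of_hasDerivAt
    (F := fun v => (v - r) ^ (1 - α) * (p - v) ^ (α - 1) / ((1 - α) * (p - r)))
    (k := fun v => (p - v) ^ (α - 2) * (v - r) ^ (-α)) hrs ?_ ?_ ?_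
  · refine ⟨this.1, this.2.trans ?_⟩
    simp [Real.zero_rpow h1'.ne']
  · refine ContinuousOn.div_const (ContinuousOn.mul ?_ ?_) _
    · exact (continuous_id.sub continuous_const).continuousOn.rpow_const
        fun x _ => Or.inr h1'.le
    · exact (continuous_const.sub continuous_id).continuousOn.rpow_const
        fun x hx => Or.inl ((sub_pos.2 (hx.2.trans_lt hsp)).ne')
  · intro v hv
    have hpv : 0 < p - v := by have := hv.2; linarith
    have hvr : 0 < v - r := by have := hv.1; linarith
    have d1 : HasDerivAt (fun v : ℝ => p - v) (-1) v := by
      simpa using (hasDerivAt_id v).const_sub p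
    have d2 : HasDerivAt (fun v : ℝ => v - r) 1 v := (hasDerivAt_id v).sub_const r
    have h2 := (((d2.rpow_const (p := 1 - α) (Or.inl hvr.ne')).mul
      (d1.rpow_const (p := α - 1) (Or.inl hpv.ne'))).div_const ((1 - α) * (p - r)))
    refine h2.congr_deriv ?_
    have e1 : (v - r) ^ (1 - α) = (v - r) ^ (-α) * (v - r) := by
      rw [show (1 - α) = -α + 1 by ring, Real.rpow_add hvr, Real.rpow_one]
    have e2 : (p - v) ^ (α - 1) = (p - v) ^ (α - 2) * (p - v) := by
      rw [show (α - 1) = α - 2 + 1 by ring, Real.rpow_add hpv, Real.rpow_one]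
    rw [show α - 1 - 1 = α - 2 by ring, show 1 - α - 1 = -α by ring, e1, e2]
    field_simp
    ring
  · intro v hv
    exact mul_nonneg (Real.rpow_nonneg (by have := hv.2; linarith) _)
      (Real.rpow_nonneg (by have := hv.1; linarith) _)

/-- The Beta integral `B(1 - α, α) = Γ(α) Γ(1 - α)`. -/
lemma lintegral_beta (h0 : 0 < α) (h1 : α < 1) :
    ∫⁻ x in Ioo (0 : ℝ) 1, ENNReal.ofReal (x ^ (-α) * (1 - x) ^ (α - 1)) =
      ENNReal.ofReal (Real.Gamma α * Real.Gamma (1 - α)) := by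
  have h1' : 0 < 1 - α := by linarith
  have hb : ProbabilityTheory.beta (1 - α) α = Real.Gamma α * Real.Gamma (1 - α) := by
    simp [ProbabilityTheory.beta, Real.Gamma_one, mul_comm]
  have hbp := ProbabilityTheory.beta_pos h1' h0
  have h2 := ProbabilityTheory.lintegral_betaPDF_eq_one h1' h0
  have h3 : ∫⁻ x, ProbabilityTheory.betaPDF (1 - α) α x =
      ∫⁻ x in Ioo (0 : ℝ) 1, ProbabilityTheory.betaPDF (1 - α) α x := by
    rw [← lintegral_indicator measurableSet_Ioo]
    refine lintegral_congr fun x => ?_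
    by_cases hx : x ∈ Ioo (0 : ℝ) 1
    · rw [indicator_of_mem hx]
    · rw [indicator_of_notMem hx]
      rcases le_or_gt x 0 with h | h
      · exact ProbabilityTheory.betaPDF_eq_zero_of_nonpos h
      · exact ProbabilityTheory.betaPDF_eq_zero_of_one_le (by
          by_contra h'
          exact hx ⟨h, not_le.1 h'⟩)
  rw [← hb]
  have h4 : ∫⁻ x in Ioo (0 : ℝ) 1, ENNReal.ofReal (x ^ (-α) * (1 - x) ^ (α - 1)) =
      ∫⁻ x in Ioo (0 : ℝ) 1, ENNReal.ofReal (ProbabilityTheory.beta (1 - α) α) *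
        ProbabilityTheory.betaPDF (1 - α) α x := by
    refine setLIntegral_congr_fun measurableSet_Ioo fun x hx => ?_
    rw [ProbabilityTheory.betaPDF_of_pos_lt_one hx.1 hx.2, ← ENNReal.ofReal_mul hbp.le]
    congr 1
    rw [show 1 - α - 1 = -α by ring]
    field_simp
  rw [h4, lintegral_const_mul', ← h3, h2, mul_one]
  exact ENNReal.ofReal_ne_top

lemma integral_beta_kernel (h0 : 0 < α) (h1 : α < 1) {r t : ℝ} (hrt : r < t) :
    IntegrableOn (fun v => (t - v) ^ (α - 1) * (v - r) ^ (-α)) (Ioo r t) ∧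
      ∫ v in Ioo r t, (t - v) ^ (α - 1) * (v - r) ^ (-α) =
        Real.Gamma α * Real.Gamma (1 - α) := by
  have htr : 0 < t - r := by linarith
  refine integrableOn_and_setIntegral_of_setLIntegral measurableSet_Ioo (by fun_prop) ?_ ?_ ?_
  · intro v hv
    exact mul_nonneg (Real.rpow_nonneg (by have := hv.2; linarith) _)
      (Real.rpow_nonneg (by have := hv.1; linarith) _)
  · exact mul_nonneg (Real.Gamma_pos_of_pos h0).le (Real.Gamma_pos_of_pos (by linarith)).le
  · have himg : (fun v => (v - r) / (t - r)) '' Ioo r t = Ioo 0 1 := by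
      ext x
      constructor
      · rintro ⟨v, hv, rfl⟩
        refine ⟨div_pos (by have := hv.1; linarith) htr, ?_⟩
        simp only
        rw [div_lt_one htr]
        have := hv.2; linarith
      · intro hx
        refine ⟨r + (t - r) * x, ⟨?_, ?_⟩, ?_⟩
        · nlinarith [hx.1]
        · nlinarith [hx.2]
        · simp only
          field_simp
          ring
    rw [← lintegral_beta h0 h1, ← himg, lintegral_image_eq_lintegral_abs_deriv_mul
      (f' := fun _ => 1 / (t - r)) measurableSet_Ioo]
    · refine setLIntegral_congr_fun measurableSet_Ioo fun v hv => ?_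
      have hv1 : 0 < v - r := by have := hv.1; linarith
      have hv2 : 0 < t - v := by have := hv.2; linarith
      rw [← ENNReal.ofReal_mul (abs_nonneg _), abs_of_pos (by positivity)]
      congr 1
      have e : 1 - (v - r) / (t - r) = (t - v) / (t - r) := by field_simp; ring
      rw [e, Real.div_rpow hv1.le htr.le, Real.div_rpow hv2.le htr.le,
        Real.rpow_sub_one htr.ne', Real.rpow_neg htr.le]
      have := Real.rpow_pos_of_pos htr α
      field_simp
    · intro v _
      exact (((hasDerivAt_id v).sub_const r).div_const _).hasDerivWithinAt
    · intro a _ b _ hab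
      simp only at hab
      field_simp at hab
      linarith

/-- The kernel `δ ^ α * v ^ (-α) / (v + δ)`, up to the factor `Γ(α) Γ(1 - α)`, has mass at most one
on `(0, ∞)`: it is the law of the overshoot of a stable subordinator. -/
lemma lintegral_overshoot_le (h0 : 0 < α) (h1 : α < 1) {δ : ℝ} (hδ : 0 < δ) (r : ℝ) :
    ∫⁻ t in Ioi (r + δ), ENNReal.ofReal (δ ^ α * (t - δ - r) ^ (-α) * (t - r)⁻¹) ≤
      ENNReal.ofReal (Real.Gamma α * Real.Gamma (1 - α)) := by
  rw [← lintegral_beta h0 h1]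
  have himg : (fun t => 1 - δ / (t - r)) '' Ioi (r + δ) ⊆ Ioo 0 1 := by
    rintro x ⟨t, ht, rfl⟩
    have ht' : r + δ < t := ht
    have : 0 < t - r := by linarith
    refine ⟨?_, ?_⟩
    · simp only
      rw [sub_pos, div_lt_one this]; linarith
    · simp only
      have : 0 < δ / (t - r) := by positivity
      linarith
  refine le_trans (le_of_eq ?_) (lintegral_mono_set himg)
  rw [lintegral_image_eq_lintegral_abs_deriv_mul (f' := fun t => δ / (t - r) ^ 2) measurableSet_Ioi]
  · refine setLIntegral_congr_fun measurableSet_Ioi fun t ht => ?_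
    have ht' : r + δ < t := ht
    have h2 : 0 < t - r := by linarith
    have h3 : 0 < t - δ - r := by linarith
    rw [← ENNReal.ofReal_mul (abs_nonneg _), abs_of_pos (by positivity)]
    congr 1
    have e : 1 - δ / (t - r) = (t - δ - r) / (t - r) := by field_simp; ring
    have e' : 1 - (1 - δ / (t - r)) = δ / (t - r) := by ring
    rw [e', e, Real.div_rpow h3.le h2.le, Real.div_rpow hδ.le h2.le,
        Real.rpow_sub_one h2.ne', Real.rpow_sub_one hδ.ne', Real.rpow_neg h2.le]
    have := Real.rpow_pos_of_pos h2 α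
    field_simp
  · intro t ht
    have ht' : r + δ < t := ht
    have h2 : t - r ≠ 0 := by linarith
    have := (((hasDerivAt_const t δ).div ((hasDerivAt_id t).sub_const r) h2).const_sub 1)
    refine (this.congr_deriv ?_).hasDerivWithinAt
    simp only [id]
    ring
  · intro a ha b hb hab
    have ha' : r + δ < a := ha
    have hb' : r + δ < b := hb
    have h2 : a - r ≠ 0 := by linarith
    have h3 : b - r ≠ 0 := by linarith
    simp only at hab
    field_simp at hab
    have : δ * (a - b) = 0 := by linarith
    rcases mul_eq_zero.1 this with h | h <;> linarith

end

/-! ### Exchanging the order of integration over a triangle -/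

lemma lintegral_triangle_swap {K : ℝ → ℝ → ENNReal} {a s : ℝ}
    (hK : AEMeasurable (Function.uncurry K)
      ((volume.restrict (Ioo a s)).prod (volume.restrict (Ioo a s)))) :
    ∫⁻ v in Ioo a s, ∫⁻ r in Ioo a v, K v r = ∫⁻ r in Ioo a s, ∫⁻ v in Ioo r s, K v r := by
  have hT : MeasurableSet {q : ℝ × ℝ | q.2 < q.1} := measurableSet_lt measurable_snd measurable_fst
  have key := lintegral_lintegral_swap (μ := volume.restrict (Ioo a s))
    (ν := volume.restrict (Ioo a s)) (f := fun v r => {q : ℝ × ℝ | q.2 < q.1}.indicator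
      (Function.uncurry K) (v, r)) (hK.indicator hT)
  have e1 : ∀ v ∈ Ioo a s, ∫⁻ r in Ioo a v, K v r = ∫⁻ r in Ioo a s,
      {q : ℝ × ℝ | q.2 < q.1}.indicator (Function.uncurry K) (v, r) := by
    intro v hv
    rw [← lintegral_indicator measurableSet_Ioo, ← lintegral_indicator measurableSet_Ioo]
    refine lintegral_congr fun r => ?_
    have := hv.2
    simp only [indicator, mem_Ioo, mem_ofPred_eq, Function.uncurry]
    split_ifs <;> grind
  have e2 : ∀ r ∈ Ioo a s, ∫⁻ v in Ioo r s, K v r = ∫⁻ v in Ioo a s,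
      {q : ℝ × ℝ | q.2 < q.1}.indicator (Function.uncurry K) (v, r) := by
    intro v hv
    rw [← lintegral_indicator measurableSet_Ioo, ← lintegral_indicator measurableSet_Ioo]
    refine lintegral_congr fun r => ?_
    have := hv.1
    simp only [indicator, mem_Ioo, mem_ofPred_eq, Function.uncurry]
    split_ifs <;> grind
  rw [setLIntegral_congr_fun measurableSet_Ioo e1, setLIntegral_congr_fun measurableSet_Ioo e2, key]

/-- Fubini's theorem on a triangle, for an integrable function and a kernel with uniformly bounded
mass. -/
lemma integral_triangle_swap {k : ℝ → ℝ → ℝ} {f : ℝ → ℝ} {a s C : ℝ}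
    (hk : Measurable (Function.uncurry k)) (hf : IntegrableOn f (Ioo a s))
    (hC : ∀ r ∈ Ioo a s, ∫⁻ v in Ioo r s, ‖k v r‖ₑ ≤ ENNReal.ofReal C) :
    (∀ᵐ v ∂(volume.restrict (Ioo a s)), IntegrableOn (fun r => k v r * f r) (Ioo a v)) ∧
      IntegrableOn (fun v => ∫ r in Ioo a v, k v r * f r) (Ioo a s) ∧
      IntegrableOn (fun r => (∫ v in Ioo r s, k v r) * f r) (Ioo a s) ∧
      ∫ v in Ioo a s, ∫ r in Ioo a v, k v r * f r =
        ∫ r in Ioo a s, (∫ v in Ioo r s, k v r) * f r := by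
  set μ := volume.restrict (Ioo a s) with hμ
  have hT : MeasurableSet {q : ℝ × ℝ | q.2 < q.1} := measurableSet_lt measurable_snd measurable_fst
  set H : ℝ × ℝ → ℝ := {q : ℝ × ℝ | q.2 < q.1}.indicator (fun q => k q.1 q.2 * f q.2) with hH
  have hsm : AEStronglyMeasurable (fun q : ℝ × ℝ => k q.1 q.2 * f q.2) (μ.prod μ) :=
    hk.aestronglyMeasurable.mul hf.aestronglyMeasurable.comp_snd
  have hHm : AEStronglyMeasurable H (μ.prod μ) := hsm.indicator hT
  have hint : Integrable H (μ.prod μ) := by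
    refine ⟨hHm, ?_⟩
    rw [hasFiniteIntegral_iff_enorm, lintegral_prod _ hHm.enorm]
    have e1 : ∀ v ∈ Ioo a s, ∫⁻ r in Ioo a s, ‖H (v, r)‖ₑ =
        ∫⁻ r in Ioo a v, ‖k v r‖ₑ * ‖f r‖ₑ := by
      intro v hv
      rw [← lintegral_indicator measurableSet_Ioo, ← lintegral_indicator measurableSet_Ioo]
      refine lintegral_congr fun r => ?_
      have := hv.2
      simp only [indicator, mem_Ioo, mem_ofPred_eq, hH]
      split_ifs
      any_goals grind
      · simp [enorm_mul]
      · simp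
    rw [hμ, setLIntegral_congr_fun measurableSet_Ioo e1, lintegral_triangle_swap]
    · calc ∫⁻ r in Ioo a s, ∫⁻ v in Ioo r s, ‖k v r‖ₑ * ‖f r‖ₑ
          ≤ ∫⁻ r in Ioo a s, ENNReal.ofReal C * ‖f r‖ₑ := by
            refine setLIntegral_mono' measurableSet_Ioo fun r hr => ?_
            rw [lintegral_mul_const' _ _ enorm_ne_top]
            gcongr
            exact hC r hr
        _ < ⊤ := by
            rw [lintegral_const_mul' _ _ ENNReal.ofReal_ne_top]
            exact ENNReal.mul_lt_top ENNReal.ofReal_lt_top hf.2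
    · exact hk.enorm.aemeasurable.mul hf.aestronglyMeasurable.comp_snd.enorm
  have i1 : ∀ v ∈ Ioo a s, ∫ r in Ioo a v, k v r * f r = ∫ r, H (v, r) ∂μ := by
    intro v hv
    rw [hμ, ← integral_indicator measurableSet_Ioo, ← integral_indicator measurableSet_Ioo]
    congr 1
    funext r
    have := hv.2
    simp only [indicator, mem_Ioo, mem_ofPred_eq, hH]
    split_ifs <;> grind
  have i2 : ∀ r ∈ Ioo a s, (∫ v in Ioo r s, k v r) * f r = ∫ v, H (v, r) ∂μ := by
    intro r hr
    rw [hμ, ← integral_mul_const, ← integral_indicator measurableSet_Ioo,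
      ← integral_indicator measurableSet_Ioo]
    congr 1
    funext v
    have := hr.1
    simp only [indicator, mem_Ioo, mem_ofPred_eq, hH]
    split_ifs <;> grind
  refine ⟨?_, ?_, ?_, ?_⟩
  · filter_upwards [hint.prod_right_ae, ae_restrict_mem measurableSet_Ioo] with v hv hvm
    have : IntegrableOn (fun r => H (v, r)) (Ioo a v) :=
      IntegrableOn.mono_set (t := Ioo a s) hv (Ioo_subset_Ioo_right hvm.2.le)
    refine this.congr_fun (fun r hr => ?_) measurableSet_Ioo
    simp [hH, hr.2]
  · exact (integrableOn_congr_fun i1 measurableSet_Ioo).2 hint.integral_prod_left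
  · exact (integrableOn_congr_fun i2 measurableSet_Ioo).2 hint.integral_prod_right
  · rw [setIntegral_congr_fun measurableSet_Ioo i1, setIntegral_congr_fun measurableSet_Ioo i2]
    exact integral_integral_swap (f := fun v r => H (v, r)) hint

lemma ae_eq_zero_of_setIntegral_eq_zero {u : ℝ → ℝ} (hu : ∀ T, IntegrableOn u (Ioo 0 T))
    (h0 : ∀ t > 0, ∫ r in Ioo 0 t, u r = 0) : ∀ᵐ t, 0 < t → u t = 0 := by
  have key : ∀ n : ℕ, ∀ᵐ t, t ∈ Ioo (0 : ℝ) n → u t = 0 := by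
    intro n
    have hn : (0 : ℝ) ≤ n := Nat.cast_nonneg n
    have hi : IntervalIntegrable u volume 0 n :=
      (intervalIntegrable_iff_integrableOn_Ioo_of_le hn).2 (hu n)
    filter_upwards [hi.ae_hasDerivAt_integral] with t ht htm
    have h1 := ht (by rw [uIcc_of_le hn]; exact Ioo_subset_Icc_self htm) 0 left_mem_uIcc
    have h2 : (fun x => ∫ s in (0 : ℝ)..x, u s) =ᶠ[nhds t] fun _ => 0 := by
      filter_upwards [Ioi_mem_nhds htm.1] with x hx
      rw [intervalIntegral.integral_of_le (le_of_lt hx), integral_Ioc_eq_integral_Ioo]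
      exact h0 x hx
    exact h1.unique ((hasDerivAt_const t (0 : ℝ)).congr_of_eventuallyEq h2)
  filter_upwards [ae_all_iff.2 key] with t ht h
  obtain ⟨n, hn⟩ := exists_nat_gt t
  exact ht n ⟨h, hn⟩

lemma lintegral_enorm_le_of_integral_le {k : ℝ → ℝ} {S : Set ℝ} {C : ℝ} (hS : MeasurableSet S)
    (hi : IntegrableOn k S) (hk : ∀ v ∈ S, 0 ≤ k v) (hC : ∫ v in S, k v ≤ C) :
    ∫⁻ v in S, ‖k v‖ₑ ≤ ENNReal.ofReal C := by
  rw [setLIntegral_congr_fun (g := fun v => ENNReal.ofReal (k v)) hS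
    (fun v hv => Real.enorm_of_nonneg (hk v hv)), setLIntegral_ofReal_eq hS hi hk]
  exact ENNReal.ofReal_le_ofReal hC

lemma setIntegral_Ioo_add {f : ℝ → ℝ} {a b c : ℝ} (hab : a ≤ b) (hbc : b ≤ c)
    (hf : IntegrableOn f (Ioo a c)) :
    ∫ r in Ioo a c, f r = (∫ r in Ioo a b, f r) + ∫ r in Ioo b c, f r := by
  rw [← integral_Ioc_eq_integral_Ioo, ← integral_Ioc_eq_integral_Ioo,
    ← integral_Ioc_eq_integral_Ioo, ← Ioc_union_Ioc_eq_Ioc hab hbc]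
  have hf' : IntegrableOn f (Ioc a c) :=
    (integrableOn_Ioc_iff_integrableOn_Ioo (by exact enorm_ne_top)).2 hf
  exact setIntegral_union (Ioc_disjoint_Ioc_of_le le_rfl) measurableSet_Ioc
    (hf'.mono_set (Ioc_subset_Ioc_right hbc)) (hf'.mono_set (Ioc_subset_Ioc_left hab))

/-! ### The equation in forward time -/

/-- The reflected problem on `(0, ∞)`: the left Riemann--Liouville integral of order `1 - α` of `y`
is almost everywhere equal to `y₀ + ∫ r in 0..t, h r`, so that `h` is the fractional derivative of
`y`.  Of the relation `h = g y` only the fact that `h` vanishes with `y` is retained.  The values at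
`t ≤ 0` play no role; global measurability is a normalisation of them. -/
structure IsForwardSolution (α y₀ : ℝ) (y h : ℝ → ℝ) : Prop where
  measurable : Measurable y
  measurable_deriv : Measurable h
  continuousOn : ContinuousOn y (Ioi 0)
  continuousOn_deriv : ContinuousOn h (Ioi 0)
  integrableOn : ∀ T, IntegrableOn y (Ioo 0 T)
  integrableOn_deriv : ∀ T, IntegrableOn h (Ioo 0 T)
  deriv_eq_zero : ∀ t > 0, y t = 0 → h t = 0
  abel : ∀ᵐ t, 0 < t → ∫ r in Ioo 0 t, (t - r) ^ (-α) * y r =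
    Real.Gamma (1 - α) * (y₀ + ∫ r in Ioo 0 t, h r)

namespace IsForwardSolution

variable {α y₀ : ℝ} {y h : ℝ → ℝ}

/-- Fractional integral of order `α` of an integrable function, integrated once more. -/
lemma _root_.setIntegral_fractional (h0 : 0 < α) {f : ℝ → ℝ} {t : ℝ}
    (hf : IntegrableOn f (Ioo 0 t)) :
    IntegrableOn (fun v => ∫ r in Ioo 0 v, (v - r) ^ (α - 1) * f r) (Ioo 0 t) ∧
    IntegrableOn (fun r => (t - r) ^ α / α * f r) (Ioo 0 t) ∧
    ∫ v in Ioo 0 t, ∫ r in Ioo 0 v, (v - r) ^ (α - 1) * f r =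
      ∫ r in Ioo 0 t, (t - r) ^ α / α * f r := by
  have hC : ∀ r ∈ Ioo 0 t, ∫⁻ v in Ioo r t, ‖(v - r) ^ (α - 1)‖ₑ ≤ ENNReal.ofReal (t ^ α / α) := by
    intro r hr
    have h1 := integral_right_power h0 hr.2.le
    refine lintegral_enorm_le_of_integral_le measurableSet_Ioo h1.1
      (fun v hv => Real.rpow_nonneg (sub_pos.2 hv.1).le _) ?_
    rw [h1.2]
    have := hr.1
    have := hr.2
    gcongr
    linarith
  obtain ⟨-, h2, h3, h4⟩ := integral_triangle_swap (k := fun v r => (v - r) ^ (α - 1))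
    (by unfold Function.uncurry; fun_prop) hf hC
  have e : ∀ r ∈ Ioo 0 t, (∫ v in Ioo r t, (v - r) ^ (α - 1)) * f r = (t - r) ^ α / α * f r :=
    fun r hr => by rw [(integral_right_power h0 hr.2.le).2]
  exact ⟨h2, (integrableOn_congr_fun e measurableSet_Ioo).1 h3,
    h4.trans (setIntegral_congr_fun measurableSet_Ioo e)⟩

/-- Abel inversion, in integrated form. -/
lemma gamma_mul_setIntegral (hy : IsForwardSolution α y₀ y h) (h0 : 0 < α) (h1 : α < 1) {t : ℝ}
    (ht : 0 < t) :
    Real.Gamma α * ∫ r in Ioo 0 t, y r =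
      y₀ * (t ^ α / α) + ∫ r in Ioo 0 t, (t - r) ^ α / α * h r := by
  have hG : 0 < Real.Gamma (1 - α) := Real.Gamma_pos_of_pos (by linarith)
  have e1 : ∫ v in Ioo 0 t, ∫ r in Ioo 0 v, ((t - v) ^ (α - 1) * (v - r) ^ (-α)) * y r =
      (Real.Gamma α * Real.Gamma (1 - α)) * ∫ r in Ioo 0 t, y r := by
    have := (integral_triangle_swap (k := fun v r => (t - v) ^ (α - 1) * (v - r) ^ (-α))
      (C := Real.Gamma α * Real.Gamma (1 - α))
      (by unfold Function.uncurry; fun_prop) (hy.integrableOn t) ?_).2.2.2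
    · rw [this, ← integral_const_mul]
      exact setIntegral_congr_fun measurableSet_Ioo fun r hr => by
        simp only [(integral_beta_kernel h0 h1 hr.2).2]
    · intro r hr
      have h1 := integral_beta_kernel h0 h1 hr.2
      exact lintegral_enorm_le_of_integral_le measurableSet_Ioo h1.1 (fun v hv => mul_nonneg
        (Real.rpow_nonneg (sub_pos.2 hv.2).le _) (Real.rpow_nonneg (sub_pos.2 hv.1).le _)) h1.2.le
  have e2 : ∫ v in Ioo 0 t, ∫ r in Ioo 0 v, (t - v) ^ (α - 1) * h r =
      ∫ r in Ioo 0 t, (t - r) ^ α / α * h r ∧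
      IntegrableOn (fun v => ∫ r in Ioo 0 v, (t - v) ^ (α - 1) * h r) (Ioo 0 t) := by
    have := (integral_triangle_swap (k := fun v _ => (t - v) ^ (α - 1)) (C := t ^ α / α)
      (by unfold Function.uncurry; fun_prop) (hy.integrableOn_deriv t) ?_).2
    · refine ⟨this.2.2.trans ?_, this.1⟩
      exact setIntegral_congr_fun measurableSet_Ioo fun r hr => by
        simp only [(integral_left_power h0 hr.2.le).2]
    · intro r hr
      have h1 := integral_left_power h0 hr.2.le
      refine lintegral_enorm_le_of_integral_le measurableSet_Ioo h1.1
        (fun v hv => Real.rpow_nonneg (sub_pos.2 hv.2).le _) ?_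
      rw [h1.2]
      have := hr.1
      have := hr.2
      gcongr
      linarith
  have e3 : ∫ v in Ioo 0 t, ∫ r in Ioo 0 v, ((t - v) ^ (α - 1) * (v - r) ^ (-α)) * y r =
      ∫ v in Ioo 0 t, Real.Gamma (1 - α) * (y₀ * (t - v) ^ (α - 1) +
        ∫ r in Ioo 0 v, (t - v) ^ (α - 1) * h r) := by
    refine setIntegral_congr_ae measurableSet_Ioo ?_
    filter_upwards [hy.abel] with v hv hvm
    simp_rw [mul_assoc]
    rw [integral_const_mul, integral_const_mul, hv hvm.1]
    ring
  have p := integral_left_power h0 ht.le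
  rw [integral_const_mul, integral_add (p.1.const_mul y₀) e2.2, integral_const_mul, p.2, e2.1, e1,
    sub_zero] at e3
  refine mul_left_cancel₀ hG.ne' ?_
  rw [← e3]
  ring

/-- The Volterra equation satisfied by a solution. -/
lemma volterra (hy : IsForwardSolution α y₀ y h) (h0 : 0 < α) (h1 : α < 1) :
    ∀ᵐ t, 0 < t → Real.Gamma α * y t =
      y₀ * t ^ (α - 1) + ∫ r in Ioo 0 t, (t - r) ^ (α - 1) * h r := by
  have p : ∀ t > 0, IntegrableOn (fun v : ℝ => v ^ (α - 1)) (Ioo 0 t) ∧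
      ∫ v in Ioo 0 t, v ^ (α - 1) = t ^ α / α := by
    intro t ht
    simpa using integral_right_power h0 ht.le
  have hI : ∀ t > 0, IntegrableOn (fun v => Real.Gamma α * y v - (y₀ * v ^ (α - 1) +
      ∫ r in Ioo 0 v, (v - r) ^ (α - 1) * h r)) (Ioo 0 t) := fun t ht =>
    ((hy.integrableOn t).const_mul _).sub (((p t ht).1.const_mul _).add
      (setIntegral_fractional h0 (hy.integrableOn_deriv t)).1)
  have key := ae_eq_zero_of_setIntegral_eq_zero (u := fun v => Real.Gamma α * y v -
    (y₀ * v ^ (α - 1) + ∫ r in Ioo 0 v, (v - r) ^ (α - 1) * h r)) ?_ ?_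
  · filter_upwards [key] with t ht h
    exact sub_eq_zero.1 (ht h)
  · intro T
    rcases le_or_gt T 0 with h | h
    · simp [Ioo_eq_empty_of_le h]
    · exact hI T h
  · intro t ht
    have f := setIntegral_fractional h0 (hy.integrableOn_deriv t)
    have g1 := ((p t ht).1.const_mul y₀)
    have e : ∫ v in Ioo 0 t, (y₀ * v ^ (α - 1) + ∫ r in Ioo 0 v, (v - r) ^ (α - 1) * h r) =
        (∫ v in Ioo 0 t, y₀ * v ^ (α - 1)) +
          ∫ v in Ioo 0 t, ∫ r in Ioo 0 v, (v - r) ^ (α - 1) * h r := integral_add g1 f.1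
    have e' : IntegrableOn (fun v => y₀ * v ^ (α - 1) +
        ∫ r in Ioo 0 v, (v - r) ^ (α - 1) * h r) (Ioo 0 t) := g1.add f.1
    rw [integral_sub ((hy.integrableOn t).const_mul _) e', e, integral_const_mul,
      integral_const_mul, (p t ht).2, f.2.2,
      hy.gamma_mul_setIntegral h0 h1 ht, sub_self]

/-- A time at which the integrals in Abel's equation and in the Volterra equation converge and both
equations hold; almost every positive time has this property. -/
structure _root_.IsRegularTime (α y₀ : ℝ) (y h : ℝ → ℝ) (t : ℝ) : Prop where
  abel : ∫ r in Ioo 0 t, (t - r) ^ (-α) * y r = Real.Gamma (1 - α) * (y₀ + ∫ r in Ioo 0 t, h r)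
  volterra : Real.Gamma α * y t = y₀ * t ^ (α - 1) + ∫ r in Ioo 0 t, (t - r) ^ (α - 1) * h r
  integrableOn_abel : IntegrableOn (fun r => (t - r) ^ (-α) * y r) (Ioo 0 t)
  integrableOn_volterra : IntegrableOn (fun r => (t - r) ^ (α - 1) * h r) (Ioo 0 t)

lemma _root_.ae_integrableOn_fractional (h0 : 0 < α) {f : ℝ → ℝ}
    (hf : ∀ T, IntegrableOn f (Ioo 0 T)) :
    ∀ᵐ t, 0 < t → IntegrableOn (fun r => (t - r) ^ (α - 1) * f r) (Ioo 0 t) := by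
  have key : ∀ n : ℕ, ∀ᵐ t, t ∈ Ioo (0 : ℝ) n →
      IntegrableOn (fun r => (t - r) ^ (α - 1) * f r) (Ioo 0 t) := by
    intro n
    rw [← ae_restrict_iff' measurableSet_Ioo]
    refine (integral_triangle_swap (k := fun v r => (v - r) ^ (α - 1)) (C := (n : ℝ) ^ α / α)
      (by unfold Function.uncurry; fun_prop) (hf n) fun r hr => ?_).1
    have h1 := integral_right_power h0 hr.2.le
    refine lintegral_enorm_le_of_integral_le measurableSet_Ioo h1.1
      (fun v hv => Real.rpow_nonneg (sub_pos.2 hv.1).le _) ?_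
    rw [h1.2]
    have := hr.1
    have := hr.2
    gcongr
    linarith
  filter_upwards [ae_all_iff.2 key] with t ht h
  obtain ⟨n, hn⟩ := exists_nat_gt t
  exact ht n ⟨h, hn⟩

lemma ae_isRegularTime (hy : IsForwardSolution α y₀ y h) (h0 : 0 < α) (h1 : α < 1) :
    ∀ᵐ t, 0 < t → IsRegularTime α y₀ y h t := by
  filter_upwards [hy.abel, hy.volterra h0 h1,
    ae_integrableOn_fractional (α := 1 - α) (by linarith) hy.integrableOn,
    ae_integrableOn_fractional h0 hy.integrableOn_deriv] with t a1 a2 a3 a4 ht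
  refine ⟨a1 ht, a2 ht, ?_, a4 ht⟩
  simpa using a3 ht

/-- Restarting the equation at time `s`: the value at `p` is an average of the values before `s`,
against the overshoot law of a stable subordinator, plus the contribution of `h` after `s`. -/
lemma restart (hy : IsForwardSolution α y₀ y h) (h1 : α < 1) {s p : ℝ} (hs : 0 < s)
    (hsp : s < p) (hrs : IsRegularTime α y₀ y h s) (hrp : IsRegularTime α y₀ y h p) :
    Real.Gamma α * y p =
      (Real.Gamma (1 - α))⁻¹ * (p - s) ^ α * (∫ r in Ioo 0 s, (s - r) ^ (-α) * (p - r)⁻¹ * y r) +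
        ∫ r in Ioo s p, (p - r) ^ (α - 1) * h r := by
  obtain ⟨habel, -, hint', -⟩ := hrs
  obtain ⟨-, hvol, -, hint⟩ := hrp
  have h1' : 0 < 1 - α := by linarith
  have hps : 0 < p - s := by linarith
  have hG : 0 < Real.Gamma (1 - α) := Real.Gamma_pos_of_pos h1'
  have hp := hs.trans hsp
  have e0 := setIntegral_Ioo_add hs.le hsp.le hint
  have hkb : ∀ r ∈ Ioo 0 s, ∫⁻ v in Ioo r s, ‖(p - v) ^ (α - 2)‖ₑ ≤
      ENNReal.ofReal ((p - s) ^ (α - 1) / (1 - α)) := by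
    intro r hr
    have q := integral_shifted_power h1 hr.2.le hsp
    refine lintegral_enorm_le_of_integral_le measurableSet_Ioo q.1 (fun v hv =>
      Real.rpow_nonneg (by have := hv.2; linarith) _) ?_
    rw [q.2]
    have : 0 ≤ (p - r) ^ (α - 1) := Real.rpow_nonneg (by have := hr.2; linarith) _
    gcongr
    linarith
  -- integration by parts, in the form of an exchange of integrals
  obtain ⟨-, i1, i1', e1⟩ := integral_triangle_swap (k := fun v _ => (p - v) ^ (α - 2))
    (by unfold Function.uncurry; fun_prop) (hy.integrableOn_deriv s) hkb
  have e2 : ∫ r in Ioo 0 s, (p - r) ^ (α - 1) * h r = (p - s) ^ (α - 1) * (∫ r in Ioo 0 s, h r) -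
      (1 - α) * ∫ v in Ioo 0 s, ∫ r in Ioo 0 v, (p - v) ^ (α - 2) * h r := by
    rw [e1, ← integral_const_mul, ← integral_const_mul, ← integral_sub
      ((hy.integrableOn_deriv s).const_mul _) (i1'.const_mul _)]
    refine setIntegral_congr_fun measurableSet_Ioo fun r hr => ?_
    rw [(integral_shifted_power h1 hr.2.le hsp).2]
    field_simp
    ring
  have hkb2 : ∀ r ∈ Ioo 0 s, ∫⁻ v in Ioo r s, ‖(p - v) ^ (α - 2) * (v - r) ^ (-α)‖ₑ ≤
      ENNReal.ofReal (s ^ (1 - α) * (p - s) ^ (α - 1) / ((1 - α) * (p - s))) := by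
    intro r hr
    have q := integral_mixed_power h1 hr.2.le hsp
    refine lintegral_enorm_le_of_integral_le measurableSet_Ioo q.1 (fun v hv => mul_nonneg
      (Real.rpow_nonneg (by have := hv.2; linarith) _)
      (Real.rpow_nonneg (by have := hv.1; linarith) _)) ?_
    rw [q.2]
    have := hr.1
    have := hr.2
    gcongr
    all_goals linarith
  obtain ⟨-, -, i3, e3⟩ := integral_triangle_swap
    (k := fun v r => (p - v) ^ (α - 2) * (v - r) ^ (-α))
    (by unfold Function.uncurry; fun_prop) (hy.integrableOn s) hkb2
  have q0 := integral_shifted_power h1 hs.le hsp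
  have e4 : ∫ v in Ioo 0 s, ∫ r in Ioo 0 v, (p - v) ^ (α - 2) * (v - r) ^ (-α) * y r =
      Real.Gamma (1 - α) * (y₀ * (((p - s) ^ (α - 1) - p ^ (α - 1)) / (1 - α)) +
        ∫ v in Ioo 0 s, ∫ r in Ioo 0 v, (p - v) ^ (α - 2) * h r) := by
    have : ∫ v in Ioo 0 s, ∫ r in Ioo 0 v, (p - v) ^ (α - 2) * (v - r) ^ (-α) * y r =
        ∫ v in Ioo 0 s, Real.Gamma (1 - α) * (y₀ * (p - v) ^ (α - 2) +
          ∫ r in Ioo 0 v, (p - v) ^ (α - 2) * h r) := by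
      refine setIntegral_congr_ae measurableSet_Ioo ?_
      filter_upwards [hy.abel] with v hv hvm
      simp_rw [mul_assoc]
      rw [integral_const_mul, integral_const_mul, hv hvm.1]
      ring
    rw [this, integral_const_mul, integral_add (q0.1.const_mul y₀) i1, integral_const_mul, q0.2,
      sub_zero]
  have e5 : (p - s) ^ (α - 1) * (∫ r in Ioo 0 s, (s - r) ^ (-α) * y r) -
      (1 - α) * (∫ r in Ioo 0 s, (∫ v in Ioo r s, (p - v) ^ (α - 2) * (v - r) ^ (-α)) * y r) =
      (p - s) ^ α * ∫ r in Ioo 0 s, (s - r) ^ (-α) * (p - r)⁻¹ * y r := by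
    rw [← integral_const_mul, ← integral_const_mul, ← integral_const_mul, ← integral_sub
      (hint'.const_mul _)]
    · refine setIntegral_congr_fun measurableSet_Ioo fun r hr => ?_
      have hsr : 0 < s - r := by have := hr.2; linarith
      have hpr : 0 < p - r := by linarith
      rw [(integral_mixed_power h1 hr.2.le hsp).2, Real.rpow_sub_one hps.ne',
        show (1 - α) = -α + 1 by ring, Real.rpow_add_one hsr.ne']
      rw [show -α + 1 = 1 - α by ring]
      field_simp
      ring
    · exact i3.const_mul _
  rw [hvol, e0, e2, mul_assoc, ← e5, ← e3, e4, habel]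
  field_simp
  ring

end IsForwardSolution

/-! ### Flux between the sets where the solution is positive and nonpositive -/

lemma measurable_setLIntegral_Ioo {K : ℝ → ℝ → ENNReal} (hK : Measurable (Function.uncurry K))
    {u v : ℝ → ℝ} (hu : Measurable u) (hv : Measurable v) :
    Measurable fun t => ∫⁻ r in Ioo (u t) (v t), K t r := by
  have hS : MeasurableSet {q : ℝ × ℝ | u q.1 < q.2 ∧ q.2 < v q.1} :=
    (measurableSet_lt (hu.comp measurable_fst) measurable_snd).inter
      (measurableSet_lt measurable_snd (hv.comp measurable_fst))
  have := (hK.indicator hS).lintegral_prod_right' (ν := volume)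
  convert this using 2 with t
  rw [← lintegral_indicator measurableSet_Ioo]
  refine lintegral_congr fun r => ?_
  simp only [indicator, mem_Ioo, mem_ofPred_eq, Function.uncurry]
  split_ifs <;> rfl

/-- For `t` with `y t ≤ 0`, the integral of `(t - r) ^ (-1 - α)` against the positive part of `y` on
`(0, t - δ)`; for the other `t`, the integral against the negative part.  It measures the jumps
longer than `δ`, backwards in time from `t`, to the set where `y` has the opposite sign. -/
noncomputable def signFlux (α : ℝ) (y : ℝ → ℝ) (δ t : ℝ) : ENNReal :=
  if y t ≤ 0 then ∫⁻ r in Ioo 0 (t - δ), ENNReal.ofReal ((t - r) ^ (-1 - α)) * ENNReal.ofReal (y r)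
  else ∫⁻ r in Ioo 0 (t - δ), ENNReal.ofReal ((t - r) ^ (-1 - α)) * ENNReal.ofReal (-y r)

lemma measurable_signFlux {α : ℝ} {y : ℝ → ℝ} (hy : Measurable y) (δ : ℝ) :
    Measurable (signFlux α y δ) := by
  unfold signFlux
  refine Measurable.ite (measurableSet_le hy measurable_const) ?_ ?_
  · refine measurable_setLIntegral_Ioo ?_ measurable_const (by fun_prop)
    unfold Function.uncurry
    fun_prop
  · refine measurable_setLIntegral_Ioo ?_ measurable_const (by fun_prop)
    unfold Function.uncurry
    fun_prop

/-- The (unnormalised) density of the overshoot over a gap of length `δ`. -/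
noncomputable def overshootKernel (α δ t r : ℝ) : ℝ := δ ^ α * (t - δ - r) ^ (-α) * (t - r)⁻¹

lemma overshootKernel_nonneg {α δ t r : ℝ} (hδ : 0 < δ) (hr : r < t - δ) :
    0 ≤ overshootKernel α δ t r := by
  have h1 : 0 < t - δ - r := by linarith
  have h2 : 0 < t - r := by linarith
  unfold overshootKernel
  positivity

lemma le_overshootKernel {α δ t r : ℝ} (h0 : 0 < α) (hδ : 0 < δ) (hr : r < t - δ) :
    δ ^ α * (t - r) ^ (-1 - α) ≤ overshootKernel α δ t r := by
  have h1 : 0 < t - δ - r := by linarith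
  have h2 : 0 < t - r := by linarith
  unfold overshootKernel
  rw [show -1 - α = -α - 1 by ring, Real.rpow_sub_one h2.ne', div_eq_mul_inv, ← mul_assoc]
  gcongr ?_ * _
  gcongr ?_ * ?_
  exact Real.rpow_le_rpow_of_nonpos h1 (by linarith) (by linarith)

lemma measurable_overshootKernel (α δ : ℝ) :
    Measurable (Function.uncurry (overshootKernel α δ)) := by
  unfold Function.uncurry overshootKernel
  fun_prop

/-- The overshoot operator does not increase the total mass. -/
lemma setLIntegral_overshoot_le {α δ τ : ℝ} (h0 : 0 < α) (h1 : α < 1) (hδ : 0 < δ)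
    {f : ℝ → ENNReal} (hf : Measurable f) :
    ∫⁻ t in Ioo δ τ, ∫⁻ r in Ioo 0 (t - δ), ENNReal.ofReal (overshootKernel α δ t r) * f r ≤
      ∫⁻ r in Ioo 0 τ, ENNReal.ofReal (Real.Gamma α * Real.Gamma (1 - α)) * f r := by
  set K : ℝ → ℝ → ENNReal := fun t r => {q : ℝ × ℝ | q.2 < q.1 - δ}.indicator
    (fun q => ENNReal.ofReal (overshootKernel α δ q.1 q.2) * f q.2) (t, r) with hK
  have hT : MeasurableSet {q : ℝ × ℝ | q.2 < q.1 - δ} :=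
    measurableSet_lt measurable_snd (by fun_prop)
  have hKm : Measurable (Function.uncurry K) :=
    Measurable.indicator ((measurable_overshootKernel α δ).ennreal_ofReal.mul
      (hf.comp measurable_snd)) hT
  calc ∫⁻ t in Ioo δ τ, ∫⁻ r in Ioo 0 (t - δ), ENNReal.ofReal (overshootKernel α δ t r) * f r
      = ∫⁻ t in Ioo δ τ, ∫⁻ r in Ioo 0 t, K t r := by
        refine setLIntegral_congr_fun measurableSet_Ioo fun t _ => ?_
        rw [← lintegral_indicator measurableSet_Ioo, ← lintegral_indicator measurableSet_Ioo]
        refine lintegral_congr fun r => ?_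
        simp only [hK, indicator, mem_Ioo, mem_ofPred_eq]
        split_ifs <;> grind
    _ ≤ ∫⁻ t in Ioo 0 τ, ∫⁻ r in Ioo 0 t, K t r :=
        lintegral_mono_set (Ioo_subset_Ioo_left hδ.le)
    _ = ∫⁻ r in Ioo 0 τ, ∫⁻ t in Ioo r τ, K t r := lintegral_triangle_swap hKm.aemeasurable
    _ ≤ ∫⁻ r in Ioo 0 τ, ENNReal.ofReal (Real.Gamma α * Real.Gamma (1 - α)) * f r := by
        refine lintegral_mono fun r => ?_
        calc ∫⁻ t in Ioo r τ, K t r ≤ ∫⁻ t, K t r := setLIntegral_le_lintegral _ _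
          _ = ∫⁻ t in Ioi (r + δ), ENNReal.ofReal (overshootKernel α δ t r) * f r := by
            rw [← lintegral_indicator measurableSet_Ioi]
            refine lintegral_congr fun t => ?_
            simp only [hK, indicator, mem_Ioi, mem_ofPred_eq]
            split_ifs <;> grind
          _ ≤ _ := by
            rw [lintegral_mul_const _ (by unfold overshootKernel; fun_prop)]
            gcongr
            exact lintegral_overshoot_le h0 h1 hδ r

/-- The fractional integral restricted to the last `δ` units of time gains a factor `δ ^ α / α` in
total mass.  With `δ = τ` nothing is cut off. -/
lemma setLIntegral_recent_le {α δ τ : ℝ} (h0 : 0 < α) (hδ : 0 ≤ δ) {f : ℝ → ENNReal}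
    (hf : Measurable f) :
    ∫⁻ t in Ioo 0 τ, ∫⁻ r in Ioo (max 0 (t - δ)) t, ENNReal.ofReal ((t - r) ^ (α - 1)) * f r ≤
      ENNReal.ofReal (δ ^ α / α) * ∫⁻ r in Ioo 0 τ, f r := by
  set K : ℝ → ℝ → ENNReal := fun t r => {q : ℝ × ℝ | q.1 - δ < q.2}.indicator
    (fun q => ENNReal.ofReal ((q.1 - q.2) ^ (α - 1)) * f q.2) (t, r) with hK
  have hT : MeasurableSet {q : ℝ × ℝ | q.1 - δ < q.2} :=
    measurableSet_lt (by fun_prop) measurable_snd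
  have hKm : Measurable (Function.uncurry K) :=
    Measurable.indicator (by fun_prop) hT
  calc ∫⁻ t in Ioo 0 τ, ∫⁻ r in Ioo (max 0 (t - δ)) t, ENNReal.ofReal ((t - r) ^ (α - 1)) * f r
      = ∫⁻ t in Ioo 0 τ, ∫⁻ r in Ioo 0 t, K t r := by
        refine setLIntegral_congr_fun measurableSet_Ioo fun t _ => ?_
        rw [← lintegral_indicator measurableSet_Ioo, ← lintegral_indicator measurableSet_Ioo]
        refine lintegral_congr fun r => ?_
        simp only [hK, indicator, mem_Ioo, mem_ofPred_eq, max_lt_iff]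
        split_ifs <;> grind
    _ = ∫⁻ r in Ioo 0 τ, ∫⁻ t in Ioo r τ, K t r := lintegral_triangle_swap hKm.aemeasurable
    _ ≤ ∫⁻ r in Ioo 0 τ, ENNReal.ofReal (δ ^ α / α) * f r := by
        refine lintegral_mono fun r => ?_
        calc ∫⁻ t in Ioo r τ, K t r ≤ ∫⁻ t in Ioi r, K t r := lintegral_mono_set Ioo_subset_Ioi_self
          _ = ∫⁻ t in Ioo r (r + δ), ENNReal.ofReal ((t - r) ^ (α - 1)) * f r := by
            rw [← lintegral_indicator measurableSet_Ioi, ← lintegral_indicator measurableSet_Ioo]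
            refine lintegral_congr fun t => ?_
            simp only [hK, indicator, mem_Ioi, mem_Ioo, mem_ofPred_eq]
            split_ifs <;> grind
          _ ≤ _ := by
            have q := integral_right_power h0 (show r ≤ r + δ by linarith)
            rw [lintegral_mul_const _ (by fun_prop), setLIntegral_ofReal_eq measurableSet_Ioo q.1
              (fun v hv => Real.rpow_nonneg (sub_pos.2 hv.1).le _), q.2, add_sub_cancel_left]
    _ = _ := lintegral_const_mul _ hf

namespace IsForwardSolution

variable {α y₀ : ℝ} {y h : ℝ → ℝ}

/-- Near the singular endpoint, the negative part of the solution is controlled by `h` alone. -/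
lemma setLIntegral_neg_part_le (hy : IsForwardSolution α y₀ y h) (h0 : 0 < α) (h1 : α < 1)
    (hy₀ : 0 ≤ y₀) {δ : ℝ} (hδ : 0 ≤ δ) :
    ∫⁻ t in Ioo 0 δ, ENNReal.ofReal (Real.Gamma α) * ENNReal.ofReal (-y t) ≤
      ENNReal.ofReal (δ ^ α / α) * ∫⁻ r in Ioo 0 δ, ‖h r‖ₑ := by
  refine le_trans ?_ (setLIntegral_recent_le (τ := δ) h0 hδ hy.measurable_deriv.enorm)
  refine setLIntegral_mono_ae' measurableSet_Ioo ?_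
  filter_upwards [hy.volterra h0 h1] with t ht htm
  have e : max 0 (t - δ) = 0 := max_eq_left (by linarith [htm.2])
  have e2 : ∫⁻ r in Ioo 0 t, ENNReal.ofReal ((t - r) ^ (α - 1)) * ‖h r‖ₑ =
      ∫⁻ r in Ioo 0 t, ‖(t - r) ^ (α - 1) * h r‖ₑ := by
    refine setLIntegral_congr_fun measurableSet_Ioo fun r hr => ?_
    rw [enorm_mul, Real.enorm_of_nonneg (Real.rpow_nonneg (sub_pos.2 hr.2).le _)]
  rw [e, e2, ← ENNReal.ofReal_mul (Real.Gamma_pos_of_pos h0).le]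
  refine le_trans ?_ (enorm_integral_le_lintegral_enorm _)
  rw [Real.enorm_eq_ofReal_abs]
  refine ENNReal.ofReal_le_ofReal ?_
  have h2 := ht htm.1
  have h3 : 0 ≤ y₀ * t ^ (α - 1) := mul_nonneg hy₀ (Real.rpow_nonneg htm.1.le _)
  have := neg_abs_le (∫ r in Ioo 0 t, (t - r) ^ (α - 1) * h r)
  linarith

/-- The pointwise balance behind the flux bound.  Let `Q` denote integration against the overshoot
kernel, so that, up to the normalisation `Γ(α) Γ(1 - α)`, restarting at `t - δ` reads `y = Q y + e`.
Where `y ≤ 0` this says `y⁻ + Q y⁺ = Q y⁻ - e`, and where `y > 0` the inequality `Q y⁻ ≤ Q y⁻` is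
trivial. -/
lemma flux_balance (hy : IsForwardSolution α y₀ y h) (h0 : 0 < α) (h1 : α < 1) {δ : ℝ}
    (hδ : 0 < δ) : ∀ᵐ t, δ < t →
    ENNReal.ofReal (δ ^ α) * signFlux α y δ t +
        ENNReal.ofReal (Real.Gamma α * Real.Gamma (1 - α)) * ENNReal.ofReal (-y t) ≤
      (∫⁻ r in Ioo 0 (t - δ), ENNReal.ofReal (overshootKernel α δ t r) * ENNReal.ofReal (-y r)) +
        ENNReal.ofReal (Real.Gamma (1 - α)) * ∫⁻ r in Ioo (max 0 (t - δ)) t,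
          ENNReal.ofReal ((t - r) ^ (α - 1)) * ‖h r‖ₑ := by
  have hG : 0 < Real.Gamma (1 - α) := Real.Gamma_pos_of_pos (by linarith)
  have hreg := hy.ae_isRegularTime h0 h1
  have hreg' := (measurePreserving_sub_right volume δ).quasiMeasurePreserving.ae hreg
  filter_upwards [hreg, hreg'] with t ht1 ht2 htδ
  have hs : 0 < t - δ := by linarith
  have hrt := ht1 (hδ.trans htδ)
  have hrs := ht2 hs
  have key := hy.restart h1 hs (by linarith : t - δ < t) hrs hrt
  set Q := overshootKernel α δ t with hQ
  have hQ0 : ∀ r ∈ Ioo 0 (t - δ), 0 ≤ Q r := fun r hr => overshootKernel_nonneg hδ hr.2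
  have hFm : ∀ f : ℝ → ℝ,
      ENNReal.ofReal (δ ^ α) * ∫⁻ r in Ioo 0 (t - δ), ENNReal.ofReal ((t - r) ^ (-1 - α)) *
        ENNReal.ofReal (f r) ≤
      ∫⁻ r in Ioo 0 (t - δ), ENNReal.ofReal (Q r) * ENNReal.ofReal (f r) := by
    intro f
    rw [← lintegral_const_mul' _ _ ENNReal.ofReal_ne_top]
    refine setLIntegral_mono' measurableSet_Ioo fun r hr => ?_
    rw [← mul_assoc, ← ENNReal.ofReal_mul (by positivity)]
    gcongr
    exact le_overshootKernel h0 hδ hr.2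
  by_cases hyt : y t ≤ 0
  swap
  · rw [ENNReal.ofReal_of_nonpos (by linarith : -y t ≤ 0), mul_zero, add_zero, signFlux, if_neg hyt]
    exact (hFm fun r => -y r).trans le_self_add
  rw [signFlux, if_pos hyt]
  refine (add_le_add_left (hFm y) _).trans ?_
  have hint : IntegrableOn (fun r => Q r * y r) (Ioo 0 (t - δ)) := by
    have h3 : IntegrableOn (fun r => δ ^ α * (t - r)⁻¹ * ((t - δ - r) ^ (-α) * y r))
        (Ioo 0 (t - δ)) := by
      refine Integrable.bdd_mul (c := δ ^ α * δ⁻¹) hrs.integrableOn_abel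
        (by fun_prop) ?_
      filter_upwards [ae_restrict_mem measurableSet_Ioo] with r hr
      have : δ < t - r := by linarith [hr.2]
      have : 0 < t - r := by linarith
      rw [Real.norm_of_nonneg (by positivity)]
      gcongr
    refine h3.congr_fun (fun r _ => ?_) measurableSet_Ioo
    simp only [hQ, overshootKernel]
    ring
  have hval : ∫ r in Ioo 0 (t - δ), Q r * y r =
      (∫⁻ r in Ioo 0 (t - δ), ENNReal.ofReal (Q r) * ENNReal.ofReal (y r)).toReal -
      (∫⁻ r in Ioo 0 (t - δ), ENNReal.ofReal (Q r) * ENNReal.ofReal (-y r)).toReal := by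
    rw [integral_eq_lintegral_pos_part_sub_lintegral_neg_part hint]
    congr 2
    · refine setLIntegral_congr_fun measurableSet_Ioo fun r hr => ?_
      exact ENNReal.ofReal_mul (hQ0 r hr)
    · refine setLIntegral_congr_fun measurableSet_Ioo fun r hr => ?_
      rw [← mul_neg, ENNReal.ofReal_mul (hQ0 r hr)]
  have hfin : ∀ f : ℝ → ℝ, (∀ r, |f r| = |y r|) →
      ∫⁻ r in Ioo 0 (t - δ), ENNReal.ofReal (Q r) * ENNReal.ofReal (f r) ≠ ⊤ := by
    intro f hf
    refine ne_of_lt (lt_of_le_of_lt ?_ hint.2)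
    refine setLIntegral_mono' measurableSet_Ioo fun r hr => ?_
    rw [enorm_mul, Real.enorm_of_nonneg (hQ0 r hr), Real.enorm_eq_ofReal_abs, ← hf]
    gcongr
    exact le_abs_self _
  have hp := hfin y fun _ => rfl
  have hm := hfin (fun r => -y r) fun _ => abs_neg _
  have hE : ENNReal.ofReal |∫ r in Ioo (t - δ) t, (t - r) ^ (α - 1) * h r| ≤
      ∫⁻ r in Ioo (max 0 (t - δ)) t, ENNReal.ofReal ((t - r) ^ (α - 1)) * ‖h r‖ₑ := by
    rw [max_eq_right hs.le, ← Real.enorm_eq_ofReal_abs]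
    refine (enorm_integral_le_lintegral_enorm _).trans (le_of_eq ?_)
    refine setLIntegral_congr_fun measurableSet_Ioo fun r hr => ?_
    rw [enorm_mul, Real.enorm_of_nonneg (Real.rpow_nonneg (sub_pos.2 hr.2).le _)]
  have key2 : ∫ r in Ioo 0 (t - δ), Q r * y r =
      δ ^ α * ∫ r in Ioo 0 (t - δ), (t - δ - r) ^ (-α) * (t - r)⁻¹ * y r := by
    rw [← integral_const_mul]
    refine setIntegral_congr_fun measurableSet_Ioo fun r _ => ?_
    simp only [hQ, overshootKernel]
    ring
  rw [sub_sub_cancel, mul_assoc, ← key2, hval] at key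
  refine le_trans ?_ (add_le_add_right (mul_le_mul_right hE _) _)
  set A := ∫⁻ r in Ioo 0 (t - δ), ENNReal.ofReal (Q r) * ENNReal.ofReal (y r)
  set B := ∫⁻ r in Ioo 0 (t - δ), ENNReal.ofReal (Q r) * ENNReal.ofReal (-y r)
  set E := ∫ r in Ioo (t - δ) t, (t - r) ^ (α - 1) * h r
  have hΓ := Real.Gamma_pos_of_pos h0
  rw [← ENNReal.ofReal_toReal hp, ← ENNReal.ofReal_toReal hm, ← ENNReal.ofReal_mul hG.le,
    ← ENNReal.ofReal_mul (by positivity),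
    ← ENNReal.ofReal_add ENNReal.toReal_nonneg (mul_nonneg (by positivity) (by linarith)),
    ← ENNReal.ofReal_add ENNReal.toReal_nonneg (by positivity)]
  refine ENNReal.ofReal_le_ofReal ?_
  have key3 : Real.Gamma α * Real.Gamma (1 - α) * y t =
      A.toReal - B.toReal + Real.Gamma (1 - α) * E := by
    rw [mul_right_comm, key]
    field_simp
  have := mul_le_mul_of_nonneg_left (neg_abs_le E) hG.le
  linarith

/-- The total flux between the positive and the nonpositive set on `(0, τ)` is bounded by the total
variation of the fractional primitive there, uniformly in the cut-off `δ`: the pointwise balance is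
integrated, and the mass of the negative part on `(δ, τ)` cancels because the overshoot operator
does not increase mass. -/
lemma setLIntegral_signFlux_le (hy : IsForwardSolution α y₀ y h) (h0 : 0 < α) (h1 : α < 1)
    (hy₀ : 0 ≤ y₀) {δ τ : ℝ} (hδ : 0 < δ) (hδτ : δ < τ) :
    ∫⁻ t in Ioo δ τ, signFlux α y δ t ≤
      ENNReal.ofReal (2 * Real.Gamma (1 - α) / α) * ∫⁻ r in Ioo 0 τ, ‖h r‖ₑ := by
  have hG : 0 < Real.Gamma (1 - α) := Real.Gamma_pos_of_pos (by linarith)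
  have hΓ := Real.Gamma_pos_of_pos h0
  set c := ENNReal.ofReal (Real.Gamma α * Real.Gamma (1 - α)) with hc
  set ε := ∫⁻ r in Ioo 0 τ, ‖h r‖ₑ
  have hym : Measurable fun t => ENNReal.ofReal (-y t) := hy.measurable.neg.ennreal_ofReal
  have hrec : Measurable fun t : ℝ => ∫⁻ r in Ioo (max 0 (t - δ)) t,
      ENNReal.ofReal ((t - r) ^ (α - 1)) * ‖h r‖ₑ := by
    refine measurable_setLIntegral_Ioo ?_ (by fun_prop) measurable_id
    have := hy.measurable_deriv
    unfold Function.uncurry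
    fun_prop
  have s1 : ∫⁻ t in Ioo δ τ, (ENNReal.ofReal (δ ^ α) * signFlux α y δ t +
      c * ENNReal.ofReal (-y t)) ≤ ∫⁻ t in Ioo δ τ,
      ((∫⁻ r in Ioo 0 (t - δ), ENNReal.ofReal (overshootKernel α δ t r) * ENNReal.ofReal (-y r)) +
        ENNReal.ofReal (Real.Gamma (1 - α)) * ∫⁻ r in Ioo (max 0 (t - δ)) t,
          ENNReal.ofReal ((t - r) ^ (α - 1)) * ‖h r‖ₑ) := by
    refine setLIntegral_mono_ae' measurableSet_Ioo ?_
    filter_upwards [hy.flux_balance h0 h1 hδ] with t ht htm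
    exact ht htm.1
  rw [lintegral_add_right _ (hym.const_mul _), lintegral_add_right _ (hrec.const_mul _),
    lintegral_const_mul _ (measurable_signFlux hy.measurable δ), lintegral_const_mul _ hrec] at s1
  have s2 := setLIntegral_overshoot_le (τ := τ) h0 h1 hδ hym
  have s3 : ∫⁻ t in Ioo δ τ, ∫⁻ r in Ioo (max 0 (t - δ)) t,
      ENNReal.ofReal ((t - r) ^ (α - 1)) * ‖h r‖ₑ ≤ ENNReal.ofReal (δ ^ α / α) * ε :=
    (lintegral_mono_set (Ioo_subset_Ioo_left hδ.le)).trans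
      (setLIntegral_recent_le (τ := τ) h0 hδ.le hy.measurable_deriv.enorm)
  have s4 : ∫⁻ r in Ioo 0 τ, c * ENNReal.ofReal (-y r) ≤
      ENNReal.ofReal (Real.Gamma (1 - α)) * (ENNReal.ofReal (δ ^ α / α) * ε) +
        ∫⁻ r in Ioo δ τ, c * ENNReal.ofReal (-y r) := by
    have e : ∫⁻ r in Ioo δ τ, c * ENNReal.ofReal (-y r) =
        ∫⁻ r in Ico δ τ, c * ENNReal.ofReal (-y r) := setLIntegral_congr Ioo_ae_eq_Ico
    rw [e, ← Ioo_union_Ico_eq_Ioo hδ hδτ.le]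
    refine (lintegral_union_le _ _ _).trans ?_
    gcongr
    have s5 := hy.setLIntegral_neg_part_le h0 h1 hy₀ hδ.le
    calc ∫⁻ r in Ioo 0 δ, c * ENNReal.ofReal (-y r)
        = ENNReal.ofReal (Real.Gamma (1 - α)) *
          ∫⁻ r in Ioo 0 δ, ENNReal.ofReal (Real.Gamma α) * ENNReal.ofReal (-y r) := by
          rw [← lintegral_const_mul _ (hym.const_mul _)]
          refine lintegral_congr fun r => ?_
          rw [← mul_assoc, ← ENNReal.ofReal_mul hG.le, hc, mul_comm (Real.Gamma α)]
      _ ≤ _ := by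
          gcongr
          refine s5.trans ?_
          gcongr
          exact lintegral_mono_set (Ioo_subset_Ioo_right hδτ.le)
  have hfin : ∫⁻ r in Ioo δ τ, c * ENNReal.ofReal (-y r) ≠ ⊤ := by
    rw [lintegral_const_mul _ hym]
    refine ENNReal.mul_ne_top ENNReal.ofReal_ne_top (ne_of_lt (lt_of_le_of_lt ?_
      ((hy.integrableOn τ).mono_set (Ioo_subset_Ioo_left hδ.le)).2))
    refine lintegral_mono fun r => ?_
    rw [Real.enorm_eq_ofReal_abs]
    exact ENNReal.ofReal_le_ofReal (neg_le_abs _)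
  have hδα : 0 < δ ^ α := Real.rpow_pos_of_pos hδ α
  have s6 : ENNReal.ofReal (δ ^ α) * ∫⁻ t in Ioo δ τ, signFlux α y δ t ≤
      ENNReal.ofReal (δ ^ α) * (ENNReal.ofReal (2 * Real.Gamma (1 - α) / α) * ε) := by
    have e : ENNReal.ofReal (δ ^ α) * (ENNReal.ofReal (2 * Real.Gamma (1 - α) / α) * ε) =
        ENNReal.ofReal (Real.Gamma (1 - α)) * (ENNReal.ofReal (δ ^ α / α) * ε) +
        ENNReal.ofReal (Real.Gamma (1 - α)) * (ENNReal.ofReal (δ ^ α / α) * ε) := by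
      rw [← two_mul, ← mul_assoc, ← mul_assoc, ← mul_assoc, ← ENNReal.ofReal_mul hδα.le,
        show (2 : ENNReal) = ENNReal.ofReal 2 by simp, ← ENNReal.ofReal_mul (by norm_num),
        ← ENNReal.ofReal_mul (by positivity)]
      congr 2
      ring
    rw [e]
    refine (ENNReal.add_le_add_iff_right hfin).1 ?_
    refine s1.trans ((add_le_add (s2.trans s4) (mul_le_mul_right s3 _)).trans (le_of_eq ?_))
    ring
  exact (ENNReal.mul_le_mul_iff_right (ENNReal.ofReal_pos.2 hδα).ne' ENNReal.ofReal_ne_top).1 s6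

/-- The flux bound without cut-off. -/
lemma setLIntegral_signFlux_zero_le (hy : IsForwardSolution α y₀ y h) (h0 : 0 < α) (h1 : α < 1)
    (hy₀ : 0 ≤ y₀) {σ τ : ℝ} (hσ : 0 < σ) (hστ : σ < τ) :
    ∫⁻ t in Ioo σ τ, signFlux α y 0 t ≤
      ENNReal.ofReal (2 * Real.Gamma (1 - α) / α) * ∫⁻ r in Ioo 0 τ, ‖h r‖ₑ := by
  set d : ℕ → ℝ := fun n => σ / (n + 1) with hd
  have hdpos : ∀ n, 0 < d n := fun n => by positivity
  have hdle : ∀ n, d n ≤ σ := fun n => div_le_self hσ.le (by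
    have : (0 : ℝ) ≤ n := Nat.cast_nonneg n
    linarith)
  have hdanti : Antitone d := fun m n hmn => by
    simp only [hd]
    gcongr
  have hdlim : ∀ t > 0, ∃ n, d n < t := by
    intro t ht
    obtain ⟨n, hn⟩ := exists_nat_gt (σ / t)
    refine ⟨n, ?_⟩
    simp only [hd]
    rw [div_lt_iff₀ ht] at hn
    rw [div_lt_iff₀ (by positivity)]
    nlinarith
  have hset : ∀ t, ⋃ n, Ioo 0 (t - d n) = Ioo 0 t := by
    intro t
    ext r
    simp only [mem_iUnion, mem_Ioo]
    constructor
    · rintro ⟨n, hn1, hn2⟩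
      exact ⟨hn1, by linarith [hdpos n]⟩
    · rintro ⟨h1, h2⟩
      obtain ⟨n, hn⟩ := hdlim (t - r) (by linarith)
      exact ⟨n, h1, by linarith⟩
  have hdir : ∀ t, Directed (· ⊆ ·) fun n => Ioo 0 (t - d n) := fun t =>
    (monotone_nat_of_le_succ fun n => Ioo_subset_Ioo_right
      (by linarith [hdanti (Nat.le_succ n)])).directed_le
  have hsup : ∀ t, signFlux α y 0 t = ⨆ n, signFlux α y (d n) t := by
    intro t
    unfold signFlux
    split_ifs
    · rw [sub_zero, ← hset t, setLIntegral_iUnion_of_directed _ (hdir t)]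
    · rw [sub_zero, ← hset t, setLIntegral_iUnion_of_directed _ (hdir t)]
  have hmono : Monotone fun n => signFlux α y (d n) := by
    intro m n hmn t
    simp only [signFlux]
    split_ifs
    · exact lintegral_mono_set (Ioo_subset_Ioo_right (by linarith [hdanti hmn]))
    · exact lintegral_mono_set (Ioo_subset_Ioo_right (by linarith [hdanti hmn]))
  simp_rw [hsup]
  rw [lintegral_iSup (fun n => measurable_signFlux hy.measurable _) hmono]
  refine iSup_le fun n => ?_
  exact (lintegral_mono_set (Ioo_subset_Ioo_left (hdle n))).trans
    (hy.setLIntegral_signFlux_le h0 h1 hy₀ (hdpos n) ((hdle n).trans_lt hστ))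

end IsForwardSolution

/-! ### Balance at a zero, and the contradiction -/

lemma exists_mem_Ioo_of_ae {P : ℝ → Prop} (hP : ∀ᵐ t, P t) {a b : ℝ} (hab : a < b) :
    ∃ t ∈ Ioo a b, P t := by
  obtain ⟨t, ht, h⟩ := (Measure.dense_of_ae hP).exists_between hab
  exact ⟨t, h, ht⟩

/-- A continuous function that is positive at `a` and nonpositive later has a first zero. -/
lemma exists_first_zero {y : ℝ → ℝ} {a b : ℝ} (hab : a < b) (hy : ContinuousOn y (Icc a b))
    (ha : 0 < y a) (hb : y b ≤ 0) :
    ∃ p ∈ Ioc a b, y p = 0 ∧ ∀ r ∈ Ico a p, 0 < y r := by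
  have hcl : IsClosed (Icc a b ∩ y ⁻¹' Iic 0) := hy.preimage_isClosed_of_isClosed isClosed_Icc
    isClosed_Iic
  obtain ⟨p, ⟨hp1, hp2⟩, hp3⟩ := (isCompact_Icc.inter_right (s := Icc a b)
    (t := Icc a b ∩ y ⁻¹' Iic 0) hcl).exists_isLeast
    ⟨b, ⟨hab.le, le_rfl⟩, ⟨hab.le, le_rfl⟩, hb⟩
  have hp4 : y p ≤ 0 := hp2.2
  have hap : a < p := lt_of_le_of_ne hp1.1 fun h => by rw [← h] at hp4; linarith
  have hlow : ∀ q ∈ Icc a b, y q ≤ 0 → p ≤ q := fun q hq hq0 => hp3 ⟨hq, hq, hq0⟩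
  refine ⟨p, ⟨hap, hp1.2⟩, ?_, fun r hr => ?_⟩
  · obtain ⟨q, hq, hq0⟩ := intermediate_value_Icc' hp1.1
      (hy.mono (Icc_subset_Icc_right hp1.2)) ⟨hp4, ha.le⟩
    have := hlow q ⟨hq.1, hq.2.trans hp1.2⟩ hq0.le
    rw [le_antisymm this hq.2, hq0]
  · by_contra hneg
    exact absurd (hlow r ⟨hr.1, hr.2.le.trans hp1.2⟩ (not_lt.1 hneg)) (not_le.2 hr.2)

namespace IsForwardSolution

variable {α y₀ : ℝ} {y h : ℝ → ℝ}

/-- At a zero `p` which the solution reaches from above, the positive values before `s₀` do not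
outweigh the negative ones: otherwise, restarting just before `p`, the past would contribute
`κ (p - s) ^ α` with `κ > 0` to the value at `p`, while `h`, being continuous with `h p = 0`,
contributes only `o((p - s) ^ α)`. -/
lemma setIntegral_le_zero_of_zero (hy : IsForwardSolution α y₀ y h) (h0 : 0 < α) (h1 : α < 1)
    {s₀ p : ℝ} (hs₀ : 0 < s₀) (hsp : s₀ < p) (hpos : ∀ r ∈ Ioo s₀ p, 0 < y r) (hp : y p = 0) :
    ∫ r in Ioo 0 s₀, (p - r) ^ (-1 - α) * y r ≤ 0 := by
  by_contra! hA
  set A := ∫ r in Ioo 0 s₀, (p - r) ^ (-1 - α) * y r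
  have hG : 0 < Real.Gamma (1 - α) := Real.Gamma_pos_of_pos (by linarith)
  have hp0 : 0 < p := hs₀.trans hsp
  set m := (s₀ + p) / 2 with hm
  have hm1 : s₀ < m := by linarith
  have hm2 : m < p := by linarith
  -- the weighted integral over the past of `s₀` is continuous in the restarting and target times
  have hcont : ContinuousAt (fun q : ℝ × ℝ => ∫ r in Ioo 0 s₀,
      (q.1 - r) ^ (-α) * (q.2 - r)⁻¹ * y r) (p, p) := by
    refine continuousAt_of_dominated (bound := fun r => (m - s₀) ^ (-α) * (m - s₀)⁻¹ * ‖y r‖)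
      ?_ ?_ ((hy.integrableOn s₀).norm.const_mul _) ?_
    · refine Filter.Eventually.of_forall fun q => ?_
      have := hy.measurable
      fun_prop
    · have hn : Ioi m ×ˢ Ioi m ∈ nhds (p, p) :=
        prod_mem_nhds (Ioi_mem_nhds hm2) (Ioi_mem_nhds hm2)
      filter_upwards [hn] with q hq
      filter_upwards [ae_restrict_mem measurableSet_Ioo] with r hr
      have q1 : m < q.1 := hq.1
      have q2 : m < q.2 := hq.2
      have hr2 := hr.2
      have a1 : 0 < m - s₀ := by linarith
      have a2 : 0 < q.1 - r := by linarith
      have a3 : 0 < q.2 - r := by linarith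
      rw [norm_mul, Real.norm_of_nonneg (by positivity)]
      gcongr ?_ * ?_ * _
      · exact Real.rpow_le_rpow_of_nonpos a1 (by linarith) (by linarith)
      · exact inv_anti₀ a1 (by linarith)
    · filter_upwards [ae_restrict_mem measurableSet_Ioo] with r hr
      have a1 : p - r ≠ 0 := by linarith [hr.2]
      refine ContinuousAt.mul (ContinuousAt.mul ?_ ?_) continuousAt_const
      · exact (continuousAt_fst.sub continuousAt_const).rpow_const (Or.inl a1)
      · exact (continuousAt_snd.sub continuousAt_const).inv₀ a1
  have hval : ∫ r in Ioo 0 s₀, (p - r) ^ (-α) * (p - r)⁻¹ * y r = A := by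
    refine setIntegral_congr_fun measurableSet_Ioo fun r hr => ?_
    have a1 : p - r ≠ 0 := by linarith [hr.2]
    rw [show -1 - α = -α - 1 by ring, Real.rpow_sub_one a1, div_eq_mul_inv]
  have hev1 : ∀ᶠ q in nhds (p, p), A / 2 <
      ∫ r in Ioo 0 s₀, (q.1 - r) ^ (-α) * (q.2 - r)⁻¹ * y r := by
    refine hcont.eventually (lt_mem_nhds ?_)
    simp only [hval]
    linarith
  rw [nhds_prod_eq] at hev1
  obtain ⟨U, hU, hUA⟩ := (Filter.eventually_prod_self_iff (r := fun a b => A / 2 <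
    ∫ r in Ioo 0 s₀, (a - r) ^ (-α) * (b - r)⁻¹ * y r)).1 hev1
  set η := α * A / (4 * Real.Gamma (1 - α)) with hη
  have hηpos : 0 < η := by positivity
  have hev2 : ∀ᶠ r in nhds p, -η < h r := by
    have hc : ContinuousAt h p := hy.continuousOn_deriv.continuousAt (Ioi_mem_nhds hp0)
    refine hc.eventually (lt_mem_nhds ?_)
    rw [hy.deriv_eq_zero p hp0 hp]
    linarith
  obtain ⟨l, u, hlu, hsub⟩ := mem_nhds_iff_exists_Ioo_subset.1
    (Filter.inter_mem (Filter.inter_mem hU hev2) (Ioi_mem_nhds hsp))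
  have hreg := hy.ae_isRegularTime h0 h1
  obtain ⟨s, ⟨hs1, hs2⟩, hs⟩ := exists_mem_Ioo_of_ae hreg hlu.1
  have hmem : ∀ r, l < r → r < p → r ∈ U ∧ -η < h r ∧ s₀ < r := fun r hr1 hr2 => by
    have := hsub ⟨hr1, hr2.trans hlu.2⟩
    exact ⟨this.1.1, this.1.2, this.2⟩
  have hss₀ : s₀ < s := (hmem s hs1 hs2).2.2
  have hs0 : 0 < s := hs₀.trans hss₀
  have hrs := hs hs0
  set κ := A / (4 * Real.Gamma (1 - α)) with hκ
  have hκpos : 0 < κ := by positivity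
  have hlow : ∀ᵐ q, q ∈ Ioo s p → κ * (q - s) ^ α ≤ Real.Gamma α * y q := by
    filter_upwards [hreg] with q hq ⟨hq1, hq2⟩
    have hrq := hq (hs0.trans hq1)
    have hqs : 0 < q - s := by linarith
    rw [hy.restart h1 hs0 hq1 hrs hrq]
    have hi : IntegrableOn (fun r => (s - r) ^ (-α) * (q - r)⁻¹ * y r) (Ioo 0 s) := by
      have h3 : IntegrableOn (fun r => (q - r)⁻¹ * ((s - r) ^ (-α) * y r)) (Ioo 0 s) := by
        refine Integrable.bdd_mul (c := (q - s)⁻¹) hrs.integrableOn_abel (by fun_prop) ?_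
        filter_upwards [ae_restrict_mem measurableSet_Ioo] with r hr
        have a2 : q - s ≤ q - r := by linarith [hr.2]
        have a3 : 0 < q - r := by linarith
        rw [Real.norm_of_nonneg (by positivity)]
        exact inv_anti₀ hqs a2
      refine h3.congr_fun (fun r _ => ?_) measurableSet_Ioo
      simp only
      ring
    have b1 : A / 2 ≤ ∫ r in Ioo 0 s, (s - r) ^ (-α) * (q - r)⁻¹ * y r := by
      rw [setIntegral_Ioo_add hs₀.le hss₀.le hi]
      have c1 := hUA s (hmem s hs1 hs2).1 q (hmem q (hs1.trans hq1) hq2).1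
      have c2 : 0 ≤ ∫ r in Ioo s₀ s, (s - r) ^ (-α) * (q - r)⁻¹ * y r := by
        refine setIntegral_nonneg measurableSet_Ioo fun r hr => ?_
        have d1 := hpos r ⟨hr.1, hr.2.trans hs2⟩
        have d2 : 0 < s - r := by linarith [hr.2]
        have d3 : 0 < q - r := by linarith
        positivity
      linarith
    have b2 : -η * ((q - s) ^ α / α) ≤ ∫ r in Ioo s q, (q - r) ^ (α - 1) * h r := by
      have e := integral_left_power h0 hq1.le
      rw [← e.2, ← integral_const_mul]
      refine setIntegral_mono_on (e.1.const_mul _)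
        (hrq.integrableOn_volterra.mono_set (Ioo_subset_Ioo_left hs0.le)) measurableSet_Ioo
        fun r hr => ?_
      rw [mul_comm]
      exact mul_le_mul_of_nonneg_left (hmem r (hs1.trans hr.1) (hr.2.trans hq2)).2.1.le
        (Real.rpow_nonneg (sub_pos.2 hr.2).le _)
    have hqα : 0 < (q - s) ^ α := Real.rpow_pos_of_pos hqs α
    calc κ * (q - s) ^ α
        = (Real.Gamma (1 - α))⁻¹ * (q - s) ^ α * (A / 2) + -η * ((q - s) ^ α / α) := by
          rw [hκ, hη]
          field_simp
          ring
      _ ≤ _ := by gcongr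
  -- the bound passes to the limit `q → p` by continuity of `y`
  have hps : 0 < p - s := by linarith
  have hc : ContinuousAt (fun q => Real.Gamma α * y q - κ * (q - s) ^ α) p := by
    have hyc : ContinuousAt y p := hy.continuousOn.continuousAt (Ioi_mem_nhds hp0)
    refine (hyc.const_mul _).sub (ContinuousAt.mul continuousAt_const ?_)
    exact (continuousAt_id.sub continuousAt_const).rpow_const (Or.inl hps.ne')
  have hev3 : ∀ᶠ q in nhds p, Real.Gamma α * y q - κ * (q - s) ^ α < 0 := by
    refine hc.eventually (gt_mem_nhds ?_)
    have : 0 < (p - s) ^ α := Real.rpow_pos_of_pos hps α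
    simp only [hp, mul_zero, zero_sub, neg_lt_zero]
    positivity
  obtain ⟨l', u', hlu', hsub'⟩ := mem_nhds_iff_exists_Ioo_subset.1
    (Filter.inter_mem hev3 (Ioi_mem_nhds hs2))
  obtain ⟨q, ⟨hq1, hq2⟩, hq⟩ := exists_mem_Ioo_of_ae hlow hlu'.1
  have h3 := hsub' ⟨hq1, hq2.trans hlu'.2⟩
  have h4 : Real.Gamma α * y q - κ * (q - s) ^ α < 0 := h3.1
  have h5 := hq ⟨h3.2, hq2⟩
  linarith

lemma _root_.exists_setLIntegral_enorm_le {f : ℝ → ℝ} (hf : IntegrableOn f (Ioo 0 1)) {e : ℝ}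
    (he : 0 < e) :
    ∃ τ₁ > 0, ∀ τ ≤ τ₁, ∫⁻ r in Ioo 0 τ, ‖f r‖ₑ ≤ ENNReal.ofReal e := by
  obtain ⟨d, hd, hds⟩ := exists_pos_setLIntegral_lt_of_measure_lt (μ := volume.restrict (Ioo 0 1))
    (f := fun r => ‖f r‖ₑ) hf.2.ne (ε := ENNReal.ofReal e) (ENNReal.ofReal_pos.2 he).ne'
  obtain ⟨d', hd', hdd⟩ := ENNReal.lt_iff_exists_nnreal_btwn.1 hd
  have hd'0 : (0 : ℝ) < d' := by exact_mod_cast hd'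
  refine ⟨min 1 d', lt_min one_pos hd'0, fun τ hτ => ?_⟩
  have hsub : Ioo 0 τ ⊆ Ioo (0 : ℝ) 1 := Ioo_subset_Ioo_right (hτ.trans (min_le_left _ _))
  have h1 := hds (Ioo 0 τ) ?_
  · rw [Measure.restrict_restrict measurableSet_Ioo, inter_eq_left.2 hsub] at h1
    exact h1.le
  · refine (Measure.restrict_apply_le _ _).trans_lt (lt_of_le_of_lt ?_ hdd)
    rw [Real.volume_Ioo, sub_zero, ← ENNReal.ofReal_coe_nnreal]
    exact ENNReal.ofReal_le_ofReal (hτ.trans (min_le_right _ _))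

/-- Close to the singular endpoint the solution has mass of order `s ^ α`. -/
lemma exists_le_setIntegral (hy : IsForwardSolution α y₀ y h) (h0 : 0 < α) (h1 : α < 1)
    (hy₀ : 0 < y₀) :
    ∃ c > 0, ∃ τ₁ > 0, ∀ s, 0 < s → s ≤ τ₁ → c * s ^ α ≤ ∫ r in Ioo 0 s, y r := by
  have hΓ := Real.Gamma_pos_of_pos h0
  obtain ⟨τ₁, hτ₁, hτ⟩ := exists_setLIntegral_enorm_le (hy.integrableOn_deriv 1)
    (e := y₀ / 2) (by positivity)
  refine ⟨y₀ / (2 * α * Real.Gamma α), by positivity, τ₁, hτ₁, fun s hs hsτ => ?_⟩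
  have key := hy.gamma_mul_setIntegral h0 h1 hs
  have hsα : 0 < s ^ α := Real.rpow_pos_of_pos hs α
  have hi := hy.integrableOn_deriv s
  have b1 : ∫ r in Ioo 0 s, ‖h r‖ ≤ y₀ / 2 := by
    rw [integral_norm_eq_lintegral_enorm hi.aestronglyMeasurable]
    exact ENNReal.toReal_le_of_le_ofReal (by positivity) (hτ s hsτ)
  have b2 : -(s ^ α / α * ∫ r in Ioo 0 s, ‖h r‖) ≤ ∫ r in Ioo 0 s, (s - r) ^ α / α * h r := by
    rw [← integral_const_mul, ← integral_neg]
    refine setIntegral_mono_on (hi.norm.const_mul _).neg (setIntegral_fractional h0 hi).2.1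
      measurableSet_Ioo fun r hr => ?_
    have d1 : 0 < s - r := sub_pos.2 hr.2
    have d2 : 0 ≤ (s - r) ^ α / α := by positivity
    have d3 : (s - r) ^ α / α ≤ s ^ α / α := by
      gcongr
      linarith [hr.1]
    rw [Real.norm_eq_abs]
    have := mul_le_mul_of_nonneg_right d3 (abs_nonneg (h r))
    have := mul_le_mul_of_nonneg_left (neg_abs_le (h r)) d2
    linarith
  have b3 : s ^ α / α * ∫ r in Ioo 0 s, ‖h r‖ ≤ s ^ α / α * (y₀ / 2) := by gcongr
  have b4 : y₀ / 2 * (s ^ α / α) ≤ Real.Gamma α * ∫ r in Ioo 0 s, y r := by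
    rw [key]
    linarith
  calc y₀ / (2 * α * Real.Gamma α) * s ^ α = (y₀ / 2 * (s ^ α / α)) / Real.Gamma α := by
        field_simp
    _ ≤ _ := by
        rw [div_le_iff₀ hΓ]
        linarith

lemma _root_.ofReal_le_setLIntegral {w : ℝ → ℝ} {S : Set ℝ} {M c : ℝ} (hM : 0 ≤ M)
    (hi : IntegrableOn w S) (hc : c ≤ ∫ r in S, w r) :
    ENNReal.ofReal (M * c) ≤ ∫⁻ r in S, ENNReal.ofReal M * ENNReal.ofReal (w r) := by
  rw [lintegral_const_mul' _ _ ENNReal.ofReal_ne_top, ENNReal.ofReal_mul hM]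
  gcongr
  refine (ENNReal.ofReal_le_ofReal hc).trans ?_
  rw [integral_eq_lintegral_pos_part_sub_lintegral_neg_part hi]
  refine (ENNReal.ofReal_le_ofReal (sub_le_self _ ENNReal.toReal_nonneg)).trans ?_
  exact ENNReal.ofReal_toReal_le

/-- Every time `t` before a nonpositive value at `τ` carries a flux, which is of order `1 / τ`
when `t` is comparable with `τ`: if `y t ≤ 0`, directly because of the positive mass before `t`,
and otherwise because of the balance at the first zero after `t`. -/
lemma le_signFlux (hy : IsForwardSolution α y₀ y h) (h0 : 0 < α) (h1 : α < 1) {c t τ : ℝ}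
    (ht : 0 < t) (htτ : t ≤ τ) (hτ : y τ ≤ 0)
    (hmass : c * t ^ α ≤ ∫ r in Ioo 0 t, y r) :
    ENNReal.ofReal (τ ^ (-1 - α) * (c * t ^ α)) ≤ signFlux α y 0 t := by
  have hτ0 : 0 < τ := ht.trans_le htτ
  have hM : 0 ≤ τ ^ (-1 - α) := Real.rpow_nonneg hτ0.le _
  have hle : ∀ p, t ≤ p → p ≤ τ → ENNReal.ofReal (τ ^ (-1 - α) * (c * t ^ α)) ≤
      ∫⁻ r in Ioo 0 t, ENNReal.ofReal ((p - r) ^ (-1 - α)) * ENNReal.ofReal (y r) := by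
    intro p hp1 hp2
    refine (ofReal_le_setLIntegral hM (hy.integrableOn t) hmass).trans ?_
    refine setLIntegral_mono' measurableSet_Ioo fun r hr => ?_
    gcongr ENNReal.ofReal ?_ * _
    exact Real.rpow_le_rpow_of_nonpos (by linarith [hr.2]) (by linarith [hr.1]) (by linarith)
  unfold signFlux
  rw [sub_zero]
  split_ifs with hyt
  · exact hle t le_rfl htτ
  rw [not_le] at hyt
  have htτ' : t < τ := lt_of_le_of_ne htτ fun e => by rw [e] at hyt; linarith
  obtain ⟨p, ⟨hp1, hp2⟩, hp, hpos⟩ := exists_first_zero htτ'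
    (hy.continuousOn.mono fun r hr => ht.trans_le hr.1) hyt hτ
  have hB := hy.setIntegral_le_zero_of_zero h0 h1 ht hp1
    (fun r hr => hpos r ⟨hr.1.le, hr.2⟩) hp
  refine (hle p hp1.le hp2).trans ?_
  have hk : ∀ r ∈ Ioo 0 t, 0 ≤ (p - r) ^ (-1 - α) := fun r hr =>
    Real.rpow_nonneg (by linarith [hr.2]) _
  have hi : IntegrableOn (fun r => (p - r) ^ (-1 - α) * y r) (Ioo 0 t) := by
    refine Integrable.bdd_mul (c := (p - t) ^ (-1 - α)) (hy.integrableOn t)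
      (by fun_prop : Measurable fun r => (p - r) ^ (-1 - α)).aestronglyMeasurable ?_
    filter_upwards [ae_restrict_mem measurableSet_Ioo] with r hr
    rw [Real.norm_of_nonneg (hk r hr)]
    exact Real.rpow_le_rpow_of_nonpos (by linarith) (by linarith [hr.2]) (by linarith)
  calc ∫⁻ r in Ioo 0 t, ENNReal.ofReal ((p - r) ^ (-1 - α)) * ENNReal.ofReal (y r)
      ≤ ∫⁻ r in Ioo 0 t, ENNReal.ofReal ((p - r) ^ (-1 - α)) * ENNReal.ofReal (-y r) := by
        rw [integral_eq_lintegral_pos_part_sub_lintegral_neg_part hi, sub_nonpos,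
          ENNReal.toReal_le_toReal] at hB
        · refine le_trans (le_of_eq ?_) (hB.trans (le_of_eq ?_))
          · refine setLIntegral_congr_fun measurableSet_Ioo fun r hr => ?_
            exact (ENNReal.ofReal_mul (hk r hr)).symm
          · refine setLIntegral_congr_fun measurableSet_Ioo fun r hr => ?_
            rw [← mul_neg, ENNReal.ofReal_mul (hk r hr)]
        · exact (Integrable.lintegral_lt_top hi).ne
        · exact (Integrable.lintegral_lt_top hi.neg).ne
    _ ≤ ∫⁻ r in Ioo 0 t, ENNReal.ofReal ((t - r) ^ (-1 - α)) * ENNReal.ofReal (-y r) := by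
        refine setLIntegral_mono' measurableSet_Ioo fun r hr => ?_
        gcongr ENNReal.ofReal ?_ * _
        exact Real.rpow_le_rpow_of_nonpos (by linarith [hr.2]) (by linarith) (by linarith)

/-- A forward solution with positive initial value is positive. -/
theorem pos (hy : IsForwardSolution α y₀ y h) (h0 : 0 < α) (h1 : α < 1) (hy₀ : 0 < y₀) :
    ∀ t > 0, 0 < y t := by
  intro t₁ ht₁
  by_contra! hneg
  have hG : 0 < Real.Gamma (1 - α) := Real.Gamma_pos_of_pos (by linarith)
  obtain ⟨c, hc, τ₁, hτ₁, hmass⟩ := hy.exists_le_setIntegral h0 h1 hy₀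
  set C := 2 * Real.Gamma (1 - α) / α with hC
  have hCpos : 0 < C := by positivity
  set e := c * (1 / 2) ^ α / (4 * C) with he
  have hepos : 0 < e := by positivity
  obtain ⟨τ₂, hτ₂, hsmall⟩ := exists_setLIntegral_enorm_le (hy.integrableOn_deriv 1) hepos
  by_cases hcase : ∃ a > 0, ∀ t ∈ Ioo 0 a, 0 < y t
  · -- the solution is positive near the endpoint, so there is no flux at early times
    obtain ⟨a, ha, hapos⟩ := hcase
    set t := min (a / 2) τ₁ with ht
    have ht0 : 0 < t := lt_min (by positivity) hτ₁
    have hta : t < a := (min_le_left _ _).trans_lt (by linarith)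
    have ht1 : t ≤ t₁ := by
      by_contra! hlt
      exact absurd (hapos t₁ ⟨ht₁, hlt.trans hta⟩) (not_lt.2 hneg)
    have key := hy.le_signFlux h0 h1 ht0 ht1 hneg (hmass t ht0 (min_le_right _ _))
    have hz : signFlux α y 0 t = 0 := by
      rw [signFlux, if_neg (not_le.2 (hapos t ⟨ht0, hta⟩)), sub_zero]
      rw [setLIntegral_congr_fun (g := fun _ => 0) measurableSet_Ioo, lintegral_zero]
      intro r hr
      have := hapos r ⟨hr.1, hr.2.trans hta⟩
      simp only
      rw [ENNReal.ofReal_of_nonpos (by linarith : -y r ≤ 0), mul_zero]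
    rw [hz, nonpos_iff_eq_zero, ENNReal.ofReal_eq_zero] at key
    have : 0 < t₁ ^ (-1 - α) * (c * t ^ α) := by positivity
    linarith
  · -- otherwise the flux over `(τ / 2, τ)` is bounded below for arbitrarily small `τ`
    push Not at hcase
    obtain ⟨τ, ⟨hτ0, hτm⟩, hτ⟩ := hcase (min τ₁ τ₂) (lt_min hτ₁ hτ₂)
    have hτ1 : τ ≤ τ₁ := hτm.le.trans (min_le_left _ _)
    have hτ2 : τ ≤ τ₂ := hτm.le.trans (min_le_right _ _)
    have up := (hy.setLIntegral_signFlux_zero_le h0 h1 hy₀.le (σ := τ / 2) (by positivity)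
      (by linarith)).trans (mul_le_mul_right (hsmall τ hτ2) _)
    have low : ENNReal.ofReal (τ ^ (-1 - α) * (c * (τ / 2) ^ α)) * ENNReal.ofReal (τ / 2) ≤
        ∫⁻ t in Ioo (τ / 2) τ, signFlux α y 0 t := by
      have hv : volume (Ioo (τ / 2) τ) = ENNReal.ofReal (τ / 2) := by
        rw [Real.volume_Ioo]
        congr 1
        ring
      rw [← hv, ← setLIntegral_const]
      refine setLIntegral_mono' measurableSet_Ioo fun t ht => ?_
      have ht0 : 0 < t := by linarith [ht.1]
      refine le_trans (ENNReal.ofReal_le_ofReal ?_) (hy.le_signFlux h0 h1 ht0 ht.2.le hτ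
        (hmass t ht0 (ht.2.le.trans hτ1)))
      have := ht.1
      gcongr
    have fin := low.trans up
    rw [← ENNReal.ofReal_mul (by positivity), ← ENNReal.ofReal_mul hCpos.le,
      ENNReal.ofReal_le_ofReal_iff (by positivity)] at fin
    have e1 : τ ^ (-1 - α) * (c * (τ / 2) ^ α) * (τ / 2) = c * (1 / 2) ^ α / 2 := by
      rw [show τ / 2 = τ * (1 / 2) by ring, Real.mul_rpow hτ0.le (by norm_num),
        show -1 - α = -(α + 1) by ring, Real.rpow_neg hτ0.le, Real.rpow_add_one hτ0.ne']
      have : 0 < τ ^ α := Real.rpow_pos_of_pos hτ0 α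
      field_simp
    have e2 : C * e = c * (1 / 2) ^ α / 4 := by
      rw [he]
      field_simp
    rw [e1, e2] at fin
    have : 0 < c * (1 / 2 : ℝ) ^ α := by positivity
    linarith

end IsForwardSolution

/-! ### Reflection of the original problem -/

lemma IsRightRLSolution.isForwardSolution {α b : ℝ} (hα1 : α < 1) {g : ℝ → ℝ}
    (hg : ContinuousOn g (Iio b)) {xb : ℝ} {x : ℝ → ℝ} (hx : IsRightRLSolution α b g xb x) :
    IsForwardSolution α xb ((Ioi 0).indicator fun t => x (b - t))
      ((Ioi 0).indicator fun t => g (b - t) * x (b - t)) := by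
  obtain ⟨hxc, J, ⟨hloc, hae, hac⟩, hde, hJb⟩ := hx
  have hmaps : MapsTo (fun t : ℝ => b - t) (Ioi 0) (Iio b) := fun t ht => by
    have : 0 < t := ht
    simp only [mem_Iio]
    linarith
  have hrefl : ContinuousOn (fun t : ℝ => b - t) (Ioi 0) := by fun_prop
  have hyc : ContinuousOn (fun t => x (b - t)) (Ioi 0) := hxc.comp hrefl hmaps
  have hhc : ContinuousOn (fun t => g (b - t) * x (b - t)) (Ioi 0) :=
    (hg.comp hrefl hmaps).mul hyc
  have hmp := Measure.measurePreserving_sub_left (volume : Measure ℝ) b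
  have hae' : ∀ᵐ t, b - t ≤ b → J (b - t) = rightRLIntegral (1 - α) b x (b - t) :=
    hmp.quasiMeasurePreserving.ae ((ae_restrict_iff' measurableSet_Iic).1 hae)
  have hde' : ∀ᵐ t, t < b → -deriv J t = g t * x t := (ae_restrict_iff' measurableSet_Iio).1 hde
  have hmeas : ∀ {f : ℝ → ℝ}, ContinuousOn f (Ioi 0) → Measurable ((Ioi 0).indicator f) := by
    intro f hf
    classical
    rw [← piecewise_eq_indicator]
    exact hf.measurable_piecewise continuousOn_const measurableSet_Ioi
  have hcongr : ∀ (f : ℝ → ℝ), EqOn ((Ioi 0).indicator f) f (Ioi 0) := fun f t ht =>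
    indicator_of_mem ht f
  have hIoo : ∀ (f : ℝ → ℝ) (T : ℝ), EqOn ((Ioi 0).indicator f) f (Ioo 0 T) := fun f T =>
    (hcongr f).mono Ioo_subset_Ioi_self
  -- transport of integrability and of integrals under the reflection
  have hint : ∀ (f : ℝ → ℝ), (∀ a < b, IntervalIntegrable f volume a b) → ∀ T,
      IntegrableOn ((Ioi 0).indicator fun t => f (b - t)) (Ioo 0 T) := by
    intro f hf T
    rcases le_or_gt T 0 with hT | hT
    · simp [Ioo_eq_empty_of_le hT]
    rw [integrableOn_congr_fun (hIoo _ T) measurableSet_Ioo,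
      ← intervalIntegrable_iff_integrableOn_Ioo_of_le hT.le]
    simpa using ((hf (b - T) (by linarith)).comp_sub_left b).symm
  have hval : ∀ (f : ℝ → ℝ) {t : ℝ}, 0 ≤ t →
      ∫ r in Ioo 0 t, f (b - r) = ∫ s in (b - t)..b, f s := by
    intro f t ht
    rw [← integral_Ioc_eq_integral_Ioo, ← intervalIntegral.integral_of_le ht,
      intervalIntegral.integral_comp_sub_left (fun s => f s) b, sub_zero]
  have hdJ : ∀ a < b, ∀ᵐ t, t ∈ uIoc a b → -deriv J t = g t * x t := by
    intro a hab
    have hb : ∀ᵐ t : ℝ, t ≠ b := by simp [ae_iff, measure_singleton]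
    filter_upwards [hde', hb] with t ht htb htm
    rw [uIoc_of_le hab.le] at htm
    exact ht (lt_of_le_of_ne htm.2 htb)
  have hgx : ∀ a < b, IntervalIntegrable (fun t => g t * x t) volume a b := fun a hab =>
    (hac a hab).intervalIntegrable_deriv.neg.congr_ae ((ae_restrict_iff' measurableSet_uIoc).2
      (hdJ a hab))
  refine ⟨hmeas hyc, hmeas hhc, hyc.congr (hcongr _), hhc.congr (hcongr _), hint x ?_,
    hint (fun t => g t * x t) hgx, ?_, ?_⟩
  · intro a hab
    rw [intervalIntegrable_iff_integrableOn_Icc_of_le hab.le]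
    exact hloc.integrableOn_compact_subset Icc_subset_Iic_self isCompact_Icc
  · intro t ht h0
    rw [hcongr _ (show t ∈ Ioi 0 from ht)] at h0 ⊢
    rw [h0, mul_zero]
  · filter_upwards [hae'] with t ht ht0
    have hG : Real.Gamma (1 - α) ≠ 0 := (Real.Gamma_pos_of_pos (by linarith)).ne'
    have hbt : b - t < b := by linarith
    have e1 : J (b - t) = xb + ∫ r in Ioo 0 t, g (b - r) * x (b - r) := by
      have h1 := (hac _ hbt).integral_deriv_eq_sub
      have h2 : ∫ s in (b - t)..b, g s * x s = ∫ s in (b - t)..b, -deriv J s :=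
        (intervalIntegral.integral_congr_ae (hdJ _ hbt)).symm
      rw [hval (fun s => g s * x s) ht0.le, h2, intervalIntegral.integral_neg, h1, hJb]
      ring
    have e2 := ht hbt.le
    rw [rightRLIntegral, if_neg (by linarith)] at e2
    rw [setIntegral_congr_fun measurableSet_Ioo (hIoo _ t), ← e1, e2, ← mul_assoc,
      mul_one_div_cancel hG, one_mul, ← hval _ ht0.le]
    refine setIntegral_congr_fun measurableSet_Ioo fun r hr => ?_
    rw [hIoo _ t hr, show b - r - (b - t) = t - r by ring, show 1 - α - 1 = -α by ring]

lemma IsRightRLSolution.neg {α b : ℝ} {g : ℝ → ℝ} {xb : ℝ} {x : ℝ → ℝ}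
    (hx : IsRightRLSolution α b g xb x) :
    IsRightRLSolution α b g (-xb) (fun t => -x t) := by
  obtain ⟨hxc, J, ⟨hloc, hae, hac⟩, hde, hJb⟩ := hx
  refine ⟨hxc.neg, fun t => -J t, ⟨hloc.neg, ?_, fun a hab => (hac a hab).neg⟩, ?_,
    congrArg Neg.neg hJb⟩
  · filter_upwards [hae] with t ht
    rw [ht]
    unfold rightRLIntegral
    split_ifs
    · rfl
    · simp only [mul_neg, intervalIntegral.integral_neg]
  · filter_upwards [hde] with t ht
    have : deriv (fun t => -J t) t = -deriv J t := deriv.fun_neg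
    rw [this, ht, mul_neg]

lemma IsRightRLSolution.pos {α b : ℝ} (hα0 : 0 < α) (hα1 : α < 1) {g : ℝ → ℝ}
    (hg : ContinuousOn g (Iio b)) {xb : ℝ} {x : ℝ → ℝ} (hx : IsRightRLSolution α b g xb x)
    (hxb : 0 < xb) : ∀ t < b, 0 < x t := by
  intro t ht
  have hbt : 0 < b - t := by linarith
  simpa [hbt, ht] using (hx.isForwardSolution hα1 hg).pos hα0 hα1 hxb (b - t) hbt

theorem mainTheorem3 (α b : ℝ) (hα0 : 0 < α) (hα1 : α < 1)
    (g : ℝ → ℝ) (hg : ContinuousOn g (Iio b))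
    (xb : ℝ) (x : ℝ → ℝ) (hx : IsRightRLSolution α b g xb x) :
    (0 < xb → ∀ t < b, 0 < x t) ∧ (xb < 0 → ∀ t < b, x t < 0) :=
  ⟨hx.pos hα0 hα1 hg, fun hxb t ht =>
    neg_pos.1 (hx.neg.pos hα0 hα1 hg (neg_pos.2 hxb) t ht)⟩
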